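/- Let $p$ be an odd prime, let $|\cdot|$ be the absolute value of $\mathbb{C}_p$ with $|p|=1/p$, and write $D^+(c,\rho)=\{t\in\mathbb{C}_p: |t-c|\le\rho\}$. A function is holomorphic on a closed disc if its values there are given by a single power series convergent on that disc. For $a\neq b$ in $\mathbb{C}_p$ the arc $\mathcal{A}(a,b)$ is the open disc $\{x:|x-b|<|a-b|\}$, and a function on $\mathcal{A}(a,b)$ is Krasner analytic if it is a uniform limit on $\mathcal{A}(a,b)$ of rational functions without poles in $\mathcal{A}(a,b)$. For $F:\mathcal{A}(a,b)\to\mathbb{C}_p$ and $N\ge 0$ put $$A_F(N)=p^{-N}\sum_{\zeta^{p^N}=1}(x_\zeta-a)F(x_\zeta),\qquad x_\zeta=a+(b-a)\zeta .$$ For an integer $\alpha\ge 0$ let $\Phi_\alpha$ be the set of the sequences $\varphi(k)=\alpha+\lambda k$, $\lambda=1,2,\dots$. We say that $\int_{\mathcal{A}(a,b),\Phi_\alpha}F(x)\,dx$ exists and equals $L\in\mathbb{C}_p$ if for every $\varepsilon>0$ there are $\varphi\in\Phi_\alpha$ and $K$ such that $|A_F(\varphi(k))-L|<\varepsilon$ for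 all $k>K$ (such an $L$ is unique). Let $a\ne b$ and $a_1$ be points of $\mathbb{C}_p$, let $r=|a-b|$ and $R>0$, and let $x(t)$ be holomorphic on $D^+(a_1,R)$ with $x(a_1)=a$. 1. The map $x$ is a bijection from $D^+(a_1,R)$ onto $D^+(a,r)$ if and only if it can be written as $x(t)=a+\gamma(t-a_1)+g(t)$ on $D^+(a_1,R)$ with $\gamma\in\mathbb{C}_p$, $|\gamma|=r/R$, and $g$ holomorphic on $D^+(a_1,R)$ with $\|g\|=\sup_{t\in D^+(a_1,R)}|g(t)|<r$. 2. (Substitution.) Suppose that $x$ is a bijection from $D^+(a_1,R)$ onto $D^+(a,r)$, and let $b_1\in D^+(a_1,R)$ be the point with $x(b_1)=b$. Then for every $f$ that is Krasner analytic on $\mathcal{A}(a,b)$ and every integer $\alpha\ge 0$, both of the following integrals exist, and $$\int_{\mathcal{A}(a,b),\Phi_\alpha}f(x)\,dx=\int_{\mathcal{A}(a_1,b_1),\Phi_\alpha}f(x(t))\,x'(t)\,dt .$$ -/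

import Mathlib

/-- `f` is holomorphic on the closed disc with centre `c` and radius `R`: its values there are given
by one convergent power series. -/
def IsHolomorphicOnDisc (p : ℕ) [Fact p.Prime] (f : ℂ_[p] → ℂ_[p]) (c : ℂ_[p]) (R : ℝ) : Prop :=
  ∃ u : ℕ → ℂ_[p], ∀ t ∈ Metric.closedBall c R, HasSum (fun n : ℕ => u n * (t - c) ^ n) (f t)

/-- The arc `𝒜(a, b)` at `b` of the circle with centre `a` through `b`: the open disc with centre `b`
and radius `|a - b|`. -/
def arc (p : ℕ) [Fact p.Prime] (a b : ℂ_[p]) : Set ℂ_[p] :=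
  Metric.ball b ‖a - b‖

/-- `f` is Krasner analytic on `S`: on `S` it is a uniform limit of rational functions without poles
in `S`. -/
def IsKrasnerAnalyticOn (p : ℕ) [Fact p.Prime] (f : ℂ_[p] → ℂ_[p]) (S : Set ℂ_[p]) : Prop :=
  ∀ ε : ℝ, 0 < ε → ∃ P Q : Polynomial ℂ_[p],
    (∀ x ∈ S, Q.eval x ≠ 0) ∧ ∀ x ∈ S, ‖f x - P.eval x / Q.eval x‖ < ε

/-- The sum `p ^ (-N) * ∑ (x - a) * f x` over the points `x = a + (b - a) * ζ`, where `ζ` runs through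
the `p ^ N`-th roots of unity. All these points lie in `arc p a b` when `a ≠ b`. -/
noncomputable def arcSum (p : ℕ) [Fact p.Prime] (a b : ℂ_[p]) (f : ℂ_[p] → ℂ_[p]) (N : ℕ) : ℂ_[p] :=
  ((p : ℂ_[p]) ^ N)⁻¹ * ∑ ζ ∈ Polynomial.nthRootsFinset (p ^ N) (1 : ℂ_[p]),
    ((a + (b - a) * ζ) - a) * f (a + (b - a) * ζ)

/-- The line integral of `f` over `𝒜(a, b)` with respect to the family `Φ` of path sequences exists
and equals `L`. -/
def HasArcIntegral (p : ℕ) [Fact p.Prime] (Φ : Set (ℕ → ℕ)) (a b : ℂ_[p]) (f : ℂ_[p] → ℂ_[p])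
    (L : ℂ_[p]) : Prop :=
  ∀ ε : ℝ, 0 < ε → ∃ K : ℕ, ∃ φ ∈ Φ, ∀ k : ℕ, K < k → ‖arcSum p a b f (φ k) - L‖ < ε

/-- The family `Φ_α` of the path sequences `k ↦ α + l * k` with `l = 1, 2, …`. -/
def pathFamily (α : ℕ) : Set (ℕ → ℕ) :=
  {φ | ∃ l : ℕ, 1 ≤ l ∧ ∀ k : ℕ, φ k = α + l * k}

/-- The value of a `Φ_α`-integral is unique. -/
theorem HasArcIntegral.unique (p : ℕ) [Fact p.Prime] {α : ℕ} {a b : ℂ_[p]} {f : ℂ_[p] → ℂ_[p]}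
    {L L' : ℂ_[p]} (h : HasArcIntegral p (pathFamily α) a b f L)
    (h' : HasArcIntegral p (pathFamily α) a b f L') : L = L' := by
  refine eq_of_forall_dist_le fun ε hε => ?_
  obtain ⟨K, φ, ⟨l, hl, hφ⟩, hK⟩ := h (ε / 2) (by positivity)
  obtain ⟨K', φ', ⟨l', hl', hφ'⟩, hK'⟩ := h' (ε / 2) (by positivity)
  have h1 := hK (l' * (K + K' + 1)) (by nlinarith)
  have h2 := hK' (l * (K + K' + 1)) (by nlinarith)
  have e : φ' (l * (K + K' + 1)) = φ (l' * (K + K' + 1)) := by rw [hφ, hφ']; ring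
  rw [e] at h2
  rw [← dist_eq_norm] at h1 h2
  rw [dist_comm] at h1
  linarith [dist_triangle L (arcSum p a b f (φ (l' * (K + K' + 1)))) L']

/-!
The argument is carried out over a complete algebraically closed ultrametric field `K` of
characteristic zero with `‖p‖ < 1`; only the algebraicity of the residue field uses `ℂ_[p]` itself. An
affine change of coordinates (`normalized`) turns both discs into the closed unit disc, `a₁` and `a`
into `0`, and, for the substitution, `b₁` and `b` into `1`.

**Bijections.** Let `F = ∑ u n * t ^ n` with `u 0 = 0`. Then `F` is a bijection of the closed unit disc
if and only if `‖u 1‖ = 1` and `‖u n‖ < 1` for `n ≥ 2`, and this condition on the coefficients is the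
decomposition `γ t + g` by Cauchy's estimate, which comes from averaging over roots of unity of order
prime to `p`. If the condition holds, a contraction argument gives surjectivity and the rest is the
ultrametric inequality (`bijOn_of_coeff`). Conversely, suppose `‖u d‖ = 1` for some `d ≥ 2`. A
truncation of `F`, re-expanded at a point `t₀` with `F' t₀ ≠ 0`, takes its value at `t₀` a second time,
because its slope polynomial has a coefficient of norm `1` of positive index and hence a zero in the
unit disc. So `F` takes there a value very close to `F t₀`, and by the inverse function theorem `F` takes
this value near `t₀` too (`not_injOn_of_norm_coeff_eq_one`).

**The arc sums.** In normalized coordinates the arc sum is `p ^ (-N) * ∑ ζ * F ζ`, the sum being over the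
`p ^ N`-th roots of unity (`rootMean`). On a power series at `1` with bounded coefficients it is bounded
by the sup norm uniformly in `N`, since the arc sums of `(t - 1) ^ n` are integers
(`norm_rootMean_le_of_hasSum`). Hence all assertions pass to uniform limits, and as Krasner analytic
functions are uniform limits of combinations of the functions `t ^ n` and `1 / (t - c)` with
`‖c - 1‖ ≥ 1` (`eval_div_eval_mem_krasnerSpace`), it is enough to treat these.

**Existence.** The arc sums of a function holomorphic on the whole closed unit disc tend to `0`, which
covers `t ^ n` and the poles with `‖c‖ > 1`. For `‖c‖ ≤ 1` the arc sum of `1 / (t - c)` is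
`1 / (1 - c ^ p ^ N)`. The residue of `c` is algebraic over the prime field, so this converges when `N`
runs through `α + l k` for a suitable `l` (`exists_tendsto_rootMean_inv_sub`).

**Substitution.** The pullback of `t ^ n`, or of `1 / (t - c)` with `‖c‖ > 1`, is again holomorphic on
the closed unit disc. If `‖c‖ ≤ 1`, write `c = F s` and `F t - c = (t - s) w t`, where `w` is close to `1`.
Then `F' / (F - c)` is `1 / (t - s)` plus a function holomorphic on the closed unit disc, and the arc sums
of `1 / (t - s)` and `1 / (t - c)` have the same asymptotics because `‖c - s‖ < 1`
(`pullback_mem_and_tendsto`).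
-/

namespace ArcIntegral

open Filter Topology Polynomial

variable {K : Type*} [NontriviallyNormedField K] [IsUltrametricDist K]

/-! ### Ultrametric estimates for sums -/

theorem norm_sub_le_of_le {x y : K} {C : ℝ} (hx : ‖x‖ ≤ C) (hy : ‖y‖ ≤ C) : ‖x - y‖ ≤ C := by
  rw [sub_eq_add_neg]
  exact (IsUltrametricDist.norm_add_le_max _ _).trans (max_le hx (by rwa [norm_neg]))

theorem norm_add_le_of_le {x y : K} {C : ℝ} (hx : ‖x‖ ≤ C) (hy : ‖y‖ ≤ C) : ‖x + y‖ ≤ C :=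
  (IsUltrametricDist.norm_add_le_max _ _).trans (max_le hx hy)

theorem norm_sub_lt_of_lt {x y : K} {C : ℝ} (hx : ‖x‖ < C) (hy : ‖y‖ < C) : ‖x - y‖ < C :=
  (norm_sub_le_of_le (le_max_left _ _) (le_max_right _ _)).trans_lt (max_lt hx hy)

theorem norm_add_lt_of_lt {x y : K} {C : ℝ} (hx : ‖x‖ < C) (hy : ‖y‖ < C) : ‖x + y‖ < C :=
  (IsUltrametricDist.norm_add_le_max _ _).trans_lt (max_lt hx hy)

/-- A strictly smaller perturbation does not change an ultrametric norm. -/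
theorem norm_eq_of_norm_sub_lt {x y : K} (h : ‖x - y‖ < ‖x‖) : ‖y‖ = ‖x‖ := by
  have h1 : y = x + -(x - y) := by ring
  have h2 : ‖x‖ ≠ ‖-(x - y)‖ := by rw [norm_neg]; exact h.ne'
  rw [h1, IsUltrametricDist.norm_add_eq_max_of_norm_ne_norm h2, norm_neg, max_eq_left h.le]

theorem norm_le_of_hasSum {ι : Type*} {f : ι → K} {x : K} {C : ℝ} (hf : HasSum f x)
    (hC : 0 ≤ C) (h : ∀ i, ‖f i‖ ≤ C) : ‖x‖ ≤ C :=
  hf.tsum_eq ▸ IsUltrametricDist.norm_tsum_le_of_forall_le_of_nonneg hC h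

omit [IsUltrametricDist K] in
theorem norm_mul_le_of_le_one {x y : K} {C : ℝ} (hx : ‖x‖ ≤ C) (hy : ‖y‖ ≤ 1) : ‖x * y‖ ≤ C := by
  rw [norm_mul]
  exact (mul_le_of_le_one_right (norm_nonneg _) hy).trans hx

omit [IsUltrametricDist K] in
theorem norm_pow_le_one {x : K} (hx : ‖x‖ ≤ 1) (n : ℕ) : ‖x ^ n‖ ≤ 1 := by
  rw [norm_pow]; exact pow_le_one₀ (norm_nonneg _) hx

omit [IsUltrametricDist K] in
/-- A null sequence all of whose terms from `m` on are smaller than `1` is bounded by some `s < 1`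
from `m` on. -/
theorem exists_lt_one_forall_norm_le {u : ℕ → K} (hu : Tendsto u atTop (𝓝 0)) {m : ℕ}
    (h : ∀ n, m ≤ n → ‖u n‖ < 1) : ∃ s, 0 ≤ s ∧ s < 1 ∧ ∀ n, m ≤ n → ‖u n‖ ≤ s := by
  have h0 : ∀ᶠ n in atTop, ‖u n‖ < 1 / 2 := by
    have := hu.norm
    rw [norm_zero] at this
    exact this.eventually (gt_mem_nhds (by norm_num))
  obtain ⟨N, hN⟩ := eventually_atTop.1 h0
  have key : ∀ N : ℕ, ∃ s, 0 ≤ s ∧ s < 1 ∧ ∀ n, m ≤ n → n < N → ‖u n‖ ≤ s := by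
    intro N
    induction N with
    | zero => exact ⟨0, le_rfl, one_pos, fun n _ h => absurd h (Nat.not_lt_zero _)⟩
    | succ N ih =>
      obtain ⟨s, hs0, hs1, hs⟩ := ih
      by_cases hmN : m ≤ N
      · refine ⟨max s ‖u N‖, hs0.trans (le_max_left _ _), max_lt hs1 (h N hmN), fun n hn hnN => ?_⟩
        rcases Nat.lt_succ_iff_lt_or_eq.1 hnN with h1 | rfl
        · exact (hs n hn h1).trans (le_max_left _ _)
        · exact le_max_right _ _
      · exact ⟨s, hs0, hs1, fun n hn hnN => absurd (hn.trans (Nat.lt_succ_iff.1 hnN)) hmN⟩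
  obtain ⟨s, hs0, hs1, hs⟩ := key N
  refine ⟨max s (1 / 2), hs0.trans (le_max_left _ _), max_lt hs1 (by norm_num), fun n hn => ?_⟩
  rcases lt_or_ge n N with h1 | h1
  · exact (hs n hn h1).trans (le_max_left _ _)
  · exact (hN n h1).le.trans (le_max_right _ _)

theorem summable_of_tendsto_zero [CompleteSpace K] {u : ℕ → K} (hu : Tendsto u atTop (𝓝 0)) :
    Summable u :=
  NonarchimedeanAddGroup.summable_of_tendsto_cofinite_zero (by rwa [Nat.cofinite_eq_atTop])

omit [IsUltrametricDist K] in
theorem tendsto_mul_zero_of_norm_le_one {u v : ℕ → K} (hu : Tendsto u atTop (𝓝 0))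
    (hv : ∀ n, ‖v n‖ ≤ 1) : Tendsto (fun n => u n * v n) atTop (𝓝 0) :=
  squeeze_zero_norm (fun n => norm_mul_le_of_le_one le_rfl (hv n)) (by simpa using hu.norm)

theorem tendsto_coeff_zero {u : ℕ → K} {y : K} (h : HasSum (fun n => u n * (1 : K) ^ n) y) :
    Tendsto u atTop (𝓝 0) := by
  simpa using h.summable.tendsto_atTop_zero

theorem apply_zero_of_hasSum {u : ℕ → K} {F : K → K}
    (hF : ∀ t, ‖t‖ ≤ 1 → HasSum (fun n => u n * t ^ n) (F t)) : F 0 = u 0 := by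
  refine (hF 0 (by simp)).unique ?_
  refine (hasSum_ite_eq 0 (u 0)).congr_fun fun n => ?_
  rcases n with _ | n <;> simp

/-! ### Power sums over roots of unity and Cauchy's estimate -/

section RootsOfUnity

omit [IsUltrametricDist K] in
theorem norm_eq_one_of_mem_nthRootsFinset {M : ℕ} (hM : 0 < M) {ζ : K}
    (hζ : ζ ∈ nthRootsFinset M (1 : K)) : ‖ζ‖ = 1 := by
  have h := congrArg norm ((mem_nthRootsFinset hM 1).1 hζ)
  rw [norm_pow, norm_one] at h
  exact (pow_eq_one_iff_of_nonneg (norm_nonneg _) hM.ne').1 h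

/-- Besides `1` itself, `p ^ j + 1` provides arbitrarily large integers that are units of the valuation
ring. -/
theorem norm_pow_add_one {p : ℕ} (hpK : ‖(p : K)‖ < 1) {j : ℕ} (hj : j ≠ 0) : ‖((p ^ j + 1 : ℕ) : K)‖ = 1 := by
  have h : ‖(1 : K) - ((p ^ j + 1 : ℕ) : K)‖ < ‖(1 : K)‖ := by
    push_cast
    rw [sub_add_cancel_right, norm_neg, norm_pow, norm_one]
    exact pow_lt_one₀ (norm_nonneg _) hpK hj
  rw [norm_eq_of_norm_sub_lt h, norm_one]

variable [IsAlgClosed K] [CharZero K]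

omit [IsUltrametricDist K] in
theorem exists_isPrimitiveRoot {M : ℕ} (hM : M ≠ 0) : ∃ ω : K, IsPrimitiveRoot ω M := by
  have : NeZero M := ⟨hM⟩
  have : NeZero (M : K) := ⟨by exact_mod_cast hM⟩
  exact HasEnoughRootsOfUnity.exists_primitiveRoot K M

omit [IsUltrametricDist K] in
theorem sum_nthRootsFinset_pow {M : ℕ} (hM : 0 < M) (m : ℕ) :
    ∑ ζ ∈ nthRootsFinset M (1 : K), ζ ^ m = if M ∣ m then (M : K) else 0 := by
  obtain ⟨ω, hω⟩ := exists_isPrimitiveRoot (K := K) hM.ne'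
  split_ifs with h
  · obtain ⟨k, rfl⟩ := h
    rw [Finset.sum_congr rfl (g := fun _ => (1 : K))]
    · simp [hω.card_nthRootsFinset]
    · intro ζ hζ
      rw [pow_mul, (mem_nthRootsFinset hM 1).1 hζ, one_pow]
  · have h1 : ω ^ m ≠ 1 := fun h1 => h ((hω.pow_eq_one_iff_dvd m).1 h1)
    have hω0 : ω ≠ 0 := hω.ne_zero hM.ne'
    have h2 : ∑ ζ ∈ nthRootsFinset M (1 : K), ζ ^ m
        = ω ^ m * ∑ ζ ∈ nthRootsFinset M (1 : K), ζ ^ m := by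
      rw [Finset.mul_sum]
      refine (Finset.sum_bij (fun ζ _ => ω * ζ) ?_ ?_ ?_ ?_).symm
      · intro ζ hζ
        rw [mem_nthRootsFinset hM] at hζ ⊢
        rw [mul_pow, hζ, hω.pow_eq_one, one_mul]
      · intro a _ b _ hab
        exact mul_left_cancel₀ hω0 hab
      · intro ζ hζ
        refine ⟨ω⁻¹ * ζ, ?_, by rw [mul_inv_cancel_left₀ hω0]⟩
        rw [mem_nthRootsFinset hM] at hζ ⊢
        rw [mul_pow, inv_pow, hζ, hω.pow_eq_one, inv_one, one_mul]
      · intro ζ _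
        rw [mul_pow]
    have h3 : (ω ^ m - 1) * ∑ ζ ∈ nthRootsFinset M (1 : K), ζ ^ m = 0 := by
      rw [sub_mul, ← h2, one_mul, sub_self]
    exact (mul_eq_zero.1 h3).resolve_left (sub_ne_zero.2 h1)

variable {p : ℕ} (hp : 1 < p) (hpK : ‖(p : K)‖ < 1)
include hp hpK

/-- Cauchy's estimate on the unit circle. A coefficient is extracted by averaging over the `M`-th
roots of unity, where `M = p ^ j + 1` is a unit of the valuation ring; the other coefficients that
survive have index at least `M`, and they become negligible as `j` grows. -/
theorem norm_coeff_le_of_norm_eq_one {u : ℕ → K} {F : K → K} {C : ℝ}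
    (hF : ∀ t, ‖t‖ = 1 → HasSum (fun n => u n * t ^ n) (F t)) (hC : ∀ t, ‖t‖ = 1 → ‖F t‖ ≤ C)
    (n : ℕ) : ‖u n‖ ≤ C := by
  have hu : Tendsto u atTop (𝓝 0) := tendsto_coeff_zero (hF 1 norm_one)
  have hC0 : 0 ≤ C := (norm_nonneg _).trans (hC 1 norm_one)
  refine le_of_forall_pos_le_add fun ε hε => ?_
  have h0 : ∀ᶠ m in atTop, ‖u m‖ < ε := by
    have := hu.norm
    rw [norm_zero] at this
    exact this.eventually (gt_mem_nhds hε)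
  obtain ⟨m₀, hm₀⟩ := eventually_atTop.1 h0
  obtain ⟨j, hj0, hjn, hjm⟩ : ∃ j : ℕ, j ≠ 0 ∧ n < p ^ j + 1 ∧ m₀ ≤ p ^ j + 1 := by
    refine ⟨n + m₀ + 1, by omega, ?_, ?_⟩ <;>
    · have := Nat.lt_pow_self hp (n := n + m₀ + 1)
      omega
  set M := p ^ j + 1 with hM
  have hMpos : 0 < M := by omega
  have hMn : ‖(M : K)‖ = 1 := norm_pow_add_one hpK hj0
  have h1 : HasSum (fun m => u m * ∑ ζ ∈ nthRootsFinset M (1 : K), ζ ^ (M - n + m))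
      (∑ ζ ∈ nthRootsFinset M (1 : K), ζ ^ (M - n) * F ζ) := by
    simp_rw [Finset.mul_sum]
    refine hasSum_sum fun ζ hζ => ?_
    have := (hF ζ (norm_eq_one_of_mem_nthRootsFinset hMpos hζ)).mul_left (ζ ^ (M - n))
    refine this.congr_fun fun m => ?_
    ring
  simp_rw [sum_nthRootsFinset_pow hMpos] at h1
  have h2 := h1.sub (hasSum_ite_eq n (u n * (M : K)))
  have h3 : ‖(∑ ζ ∈ nthRootsFinset M (1 : K), ζ ^ (M - n) * F ζ) - u n * (M : K)‖ ≤ ε := by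
    refine norm_le_of_hasSum h2 hε.le fun m => ?_
    by_cases hmn : m = n
    · have hd : M ∣ M - n + n := by rw [Nat.sub_add_cancel hjn.le]
      subst hmn
      simp [hd, hε.le]
    · rw [if_neg hmn, sub_zero]
      split_ifs with hd
      · obtain ⟨k, hk⟩ := hd
        have hk2 : 2 ≤ k := by
          rcases k with _ | _ | k
          · omega
          · omega
          · omega
        have : 2 * M ≤ M * k := by nlinarith
        exact norm_mul_le_of_le_one (hm₀ m (by omega)).le hMn.le
      · simpa using hε.le
  have h4 : ‖∑ ζ ∈ nthRootsFinset M (1 : K), ζ ^ (M - n) * F ζ‖ ≤ C := by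
    refine IsUltrametricDist.norm_sum_le_of_forall_le_of_nonneg hC0 fun ζ hζ => ?_
    have h := norm_eq_one_of_mem_nthRootsFinset hMpos hζ
    rw [norm_mul, norm_pow, h, one_pow, one_mul]
    exact hC ζ h
  have h5 : ‖u n * (M : K)‖ ≤ C + ε := by
    have : u n * (M : K) = (∑ ζ ∈ nthRootsFinset M (1 : K), ζ ^ (M - n) * F ζ)
      - ((∑ ζ ∈ nthRootsFinset M (1 : K), ζ ^ (M - n) * F ζ) - u n * (M : K)) := by ring
    rw [this]
    exact norm_sub_le_of_le (by linarith) (by linarith)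
  rwa [norm_mul, hMn, mul_one] at h5

theorem norm_coeff_mul_pow_le {u : ℕ → K} {F : K → K} {C : ℝ} (κ : K)
    (hF : ∀ t, ‖t‖ = ‖κ‖ → HasSum (fun n => u n * t ^ n) (F t))
    (hC : ∀ t, ‖t‖ = ‖κ‖ → ‖F t‖ ≤ C) (n : ℕ) : ‖u n‖ * ‖κ‖ ^ n ≤ C := by
  rw [← norm_pow, ← norm_mul]
  have hκ : ∀ t : K, ‖t‖ = 1 → ‖κ * t‖ = ‖κ‖ := fun t ht => by rw [norm_mul, ht, mul_one]
  refine norm_coeff_le_of_norm_eq_one hp hpK (u := fun n => u n * κ ^ n) (F := fun t => F (κ * t))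
    (fun t ht => ?_) (fun t ht => hC _ (hκ t ht)) n
  refine (hF _ (hκ t ht)).congr_fun fun m => ?_
  rw [mul_pow, mul_assoc]

omit [IsUltrametricDist K] in
/-- The value group is dense near `1`. -/
theorem exists_norm_between {r : ℝ} (hr : r < 1) : ∃ z : K, r < ‖z‖ ∧ ‖z‖ < 1 := by
  by_contra! H
  have hp0 : 0 < ‖(p : K)‖ := norm_pos_iff.2 (by exact_mod_cast (by omega : p ≠ 0))
  have hr0 : 0 ≤ r := by
    by_contra! h
    exact absurd (H 0 (by simpa using h)) (by simp)
  obtain ⟨n, hn⟩ := exists_pow_lt_of_lt_one hp0 hr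
  have hn0 : 0 < n := by
    rcases Nat.eq_zero_or_pos n with rfl | h
    · rw [pow_zero] at hn; exact absurd hpK hn.not_gt
    · exact h
  obtain ⟨z, hz⟩ := IsAlgClosed.exists_pow_nat_eq (p : K) hn0
  have hz' : ‖z‖ ^ n = ‖(p : K)‖ := by rw [← norm_pow, hz]
  have hz1 : ‖z‖ < 1 := by
    by_contra! h
    exact absurd hpK (hz' ▸ one_le_pow₀ h).not_gt
  have hz2 : ‖z‖ ≤ r := by
    by_contra! h
    exact absurd hz1 (H z h).not_gt
  exact absurd hn (hz' ▸ pow_le_pow_left₀ (norm_nonneg _) hz2 n).not_gt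

end RootsOfUnity

/-! ### Roots of polynomials in the closed unit disc -/

/-- If all zeros lie outside the closed unit disc, then the constant coefficient strictly dominates
all the others. -/
theorem norm_coeff_prod_lt (s : Multiset K) (hs : ∀ a ∈ s, 1 < ‖a‖) (n : ℕ) (hn : 1 ≤ n) :
    ‖((s.map fun a => X - C a).prod).coeff n‖ < ‖((s.map fun a => X - C a).prod).coeff 0‖ := by
  induction s using Multiset.induction_on generalizing n with
  | empty =>
    simp [coeff_one, Nat.one_le_iff_ne_zero.1 hn]
  | cons a s ih =>
    have ih' := ih fun b hb => hs b (Multiset.mem_cons_of_mem hb)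
    have ha := hs a (Multiset.mem_cons_self a s)
    obtain ⟨n, rfl⟩ : ∃ k, n = k + 1 := ⟨n - 1, by omega⟩
    rw [Multiset.map_cons, Multiset.prod_cons]
    set Q := (s.map fun a => X - C a).prod
    have h0 : 0 < ‖Q.coeff 0‖ := (norm_nonneg _).trans_lt (ih' 1 le_rfl)
    have hle : ‖Q.coeff n‖ ≤ ‖Q.coeff 0‖ := by
      rcases Nat.eq_zero_or_pos n with rfl | h
      · exact le_rfl
      · exact (ih' n h).le
    have e1 : ((X - C a) * Q).coeff (n + 1) = Q.coeff n - a * Q.coeff (n + 1) := by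
      rw [sub_mul, coeff_sub, coeff_X_mul, coeff_C_mul]
    have e2 : ‖((X - C a) * Q).coeff 0‖ = ‖a‖ * ‖Q.coeff 0‖ := by
      rw [sub_mul, coeff_sub, coeff_C_mul]
      simp
    rw [e1, e2]
    refine norm_sub_lt_of_lt ?_ ?_
    · exact hle.trans_lt (by nlinarith)
    · rw [norm_mul]
      exact mul_lt_mul_of_pos_left (ih' _ (by omega)) (by linarith)

/-- Otherwise the constant coefficient would strictly dominate all others, by `norm_coeff_prod_lt`. -/
theorem exists_root_norm_le_one [IsAlgClosed K] {P : K[X]} (hP : ∀ n, ‖P.coeff n‖ ≤ 1) {m : ℕ}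
    (hm : 1 ≤ m) (hPm : ‖P.coeff m‖ = 1) : ∃ h, ‖h‖ ≤ 1 ∧ P.eval h = 0 := by
  by_contra! H
  have hP0 : P ≠ 0 := by
    rintro rfl
    simp at hPm
  have h1 : ∀ a ∈ P.roots, 1 < ‖a‖ := by
    intro a ha
    by_contra! hle
    exact H a hle (isRoot_of_mem_roots ha)
  have h2 := norm_coeff_prod_lt P.roots h1 m hm
  have h3 := (IsAlgClosed.splits P).eq_prod_roots
  have hl : 0 < ‖P.leadingCoeff‖ := norm_pos_iff.2 (leadingCoeff_ne_zero.2 hP0)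
  have h4 : ∀ n, ‖P.coeff n‖
      = ‖P.leadingCoeff‖ * ‖((P.roots.map fun a => X - C a).prod).coeff n‖ := by
    intro n
    conv_lhs => rw [h3]
    rw [coeff_C_mul, norm_mul]
  have h5 := mul_lt_mul_of_pos_left h2 hl
  rw [← h4, ← h4, hPm] at h5
  exact absurd (hP 0) h5.not_ge

/-! ### The ultrametric inverse function theorem -/

/-- If `F` differs from a linear map of slope `c` by a map with a Lipschitz constant less than `‖c‖`, then
the image under `F` of a closed disc contains the disc with radius scaled by `‖c‖`: Newton's iteration
with the constant slope `c` is a contraction of the disc. -/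
theorem exists_preimage_of_approx [CompleteSpace K] {F : K → K} {c t₀ y : K} {k ρ : ℝ}
    (hk : 0 ≤ k) (hc : k < ‖c‖) (hρ : 0 ≤ ρ)
    (h : ∀ t s, ‖t - t₀‖ ≤ ρ → ‖s - t₀‖ ≤ ρ → ‖F t - F s - c * (t - s)‖ ≤ k * ‖t - s‖)
    (hy : ‖y - F t₀‖ ≤ ‖c‖ * ρ) : ∃ t, ‖t - t₀‖ ≤ ρ ∧ F t = y := by
  have hc0 : 0 < ‖c‖ := hk.trans_lt hc
  have hc1 : c ≠ 0 := norm_pos_iff.1 hc0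
  set Φ : K → K := fun t => t - c⁻¹ * (F t - y) with hΦ
  have hd : ∀ t s, ‖t - t₀‖ ≤ ρ → ‖s - t₀‖ ≤ ρ → ‖Φ t - Φ s‖ ≤ k / ‖c‖ * ‖t - s‖ := by
    intro t s ht hs
    have e : Φ t - Φ s = -(c⁻¹ * (F t - F s - c * (t - s))) := by
      simp only [hΦ]
      field_simp
      ring
    rw [e, norm_neg, norm_mul, norm_inv, div_mul_eq_mul_div, div_eq_inv_mul]
    exact mul_le_mul_of_nonneg_left (h t s ht hs) (inv_nonneg.2 hc0.le)
  have hkc : k / ‖c‖ < 1 := (div_lt_one hc0).2 hc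
  have hm : Set.MapsTo Φ (Metric.closedBall t₀ ρ) (Metric.closedBall t₀ ρ) := by
    intro t ht
    rw [mem_closedBall_iff_norm] at ht ⊢
    have h1 := hd t t₀ ht (by simpa using hρ)
    have h2 : ‖Φ t₀ - t₀‖ ≤ ρ := by
      have e : Φ t₀ - t₀ = c⁻¹ * (y - F t₀) := by simp only [hΦ]; ring
      rw [e, norm_mul, norm_inv, inv_mul_le_iff₀ hc0]
      exact hy
    have e : Φ t - t₀ = (Φ t - Φ t₀) + (Φ t₀ - t₀) := by ring
    rw [e]
    refine norm_add_le_of_le (h1.trans ?_) h2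
    exact (mul_le_of_le_one_left (norm_nonneg _) hkc.le).trans ht
  have hcontr : ContractingWith ⟨k / ‖c‖, div_nonneg hk hc0.le⟩
      (hm.restrict Φ (Metric.closedBall t₀ ρ) (Metric.closedBall t₀ ρ)) := by
    refine ⟨by exact_mod_cast hkc, LipschitzWith.of_dist_le_mul fun t s => ?_⟩
    rw [Subtype.dist_eq, Subtype.dist_eq, dist_eq_norm, dist_eq_norm]
    exact hd t s (mem_closedBall_iff_norm.1 t.2) (mem_closedBall_iff_norm.1 s.2)
  obtain ⟨t, ht, hfix, -⟩ := hcontr.exists_fixedPoint' (Metric.isClosed_closedBall.isComplete)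
    hm (Metric.mem_closedBall_self hρ) (edist_ne_top _ _)
  refine ⟨t, mem_closedBall_iff_norm.1 ht, ?_⟩
  have h1 : c⁻¹ * (F t - y) = 0 := by
    have : t - c⁻¹ * (F t - y) = t := hfix
    simpa using this
  exact sub_eq_zero.1 ((mul_eq_zero.1 h1).resolve_left (inv_ne_zero hc1))

/-! ### Power series on the closed unit disc -/

/-- The divided difference of `X ^ n` at `t` and `s`. -/
def dividedPow (n : ℕ) (t s : K) : K :=
  ∑ i ∈ Finset.range n, t ^ i * s ^ (n - 1 - i)

omit [IsUltrametricDist K] in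
theorem dividedPow_mul_sub (n : ℕ) (t s : K) : dividedPow n t s * (t - s) = t ^ n - s ^ n :=
  geom_sum₂_mul t s n

theorem norm_dividedPow_le {t s : K} (ht : ‖t‖ ≤ 1) (hs : ‖s‖ ≤ 1) (n : ℕ) :
    ‖dividedPow n t s‖ ≤ 1 :=
  IsUltrametricDist.norm_sum_le_of_forall_le_of_nonneg zero_le_one fun i _ =>
    norm_mul_le_of_le_one (norm_pow_le_one ht i) (norm_pow_le_one hs _)

theorem norm_pow_sub_pow_le {t s : K} (ht : ‖t‖ ≤ 1) (hs : ‖s‖ ≤ 1) (n : ℕ) :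
    ‖t ^ n - s ^ n‖ ≤ ‖t - s‖ := by
  rw [← dividedPow_mul_sub, mul_comm]
  exact norm_mul_le_of_le_one le_rfl (norm_dividedPow_le ht hs n)

theorem norm_dividedPow_sub_le {t s r : K} {ρ : ℝ} (ht : ‖t‖ ≤ 1) (hs : ‖s‖ ≤ 1) (hr : ‖r‖ ≤ 1)
    (hρ : 0 ≤ ρ) (htr : ‖t - r‖ ≤ ρ) (hsr : ‖s - r‖ ≤ ρ) (n : ℕ) :
    ‖dividedPow n t s - n * r ^ (n - 1)‖ ≤ ρ := by
  have e : dividedPow n t s - n * r ^ (n - 1)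
      = ∑ i ∈ Finset.range n, (t ^ i * s ^ (n - 1 - i) - r ^ i * r ^ (n - 1 - i)) := by
    rw [Finset.sum_sub_distrib, dividedPow]
    congr 1
    rw [Finset.sum_congr rfl (g := fun _ => r ^ (n - 1))]
    · simp
    · intro i hi
      rw [← pow_add]
      congr 1
      have := Finset.mem_range.1 hi
      omega
  rw [e]
  refine IsUltrametricDist.norm_sum_le_of_forall_le_of_nonneg hρ fun i _ => ?_
  have e2 : t ^ i * s ^ (n - 1 - i) - r ^ i * r ^ (n - 1 - i)
      = (t ^ i - r ^ i) * s ^ (n - 1 - i) + (s ^ (n - 1 - i) - r ^ (n - 1 - i)) * r ^ i := by ring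
  rw [e2]
  exact norm_add_le_of_le
    (norm_mul_le_of_le_one ((norm_pow_sub_pow_le ht hr i).trans htr) (norm_pow_le_one hs _))
    (norm_mul_le_of_le_one ((norm_pow_sub_pow_le hs hr _).trans hsr) (norm_pow_le_one hr _))

/-- The divided difference at `t` and `s` of `n t ^ (n - 1) - dividedPow n t s`, which vanishes at
`t = s`. -/
def secondDividedPow (n : ℕ) (t s : K) : K :=
  ∑ i ∈ Finset.range n, t ^ i * dividedPow (n - 1 - i) t s

omit [IsUltrametricDist K] in
theorem secondDividedPow_mul_sub (n : ℕ) (t s : K) :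
    secondDividedPow n t s * (t - s) = n * t ^ (n - 1) - dividedPow n t s := by
  rw [secondDividedPow, Finset.sum_mul]
  simp_rw [mul_assoc, dividedPow_mul_sub, mul_sub]
  rw [Finset.sum_sub_distrib, ← dividedPow]
  congr 1
  rw [dividedPow, Finset.sum_congr rfl (g := fun _ => t ^ (n - 1))]
  · simp
  · intro i hi
    rw [← pow_add]
    congr 1
    have := Finset.mem_range.1 hi
    omega

theorem norm_secondDividedPow_le {t s : K} (ht : ‖t‖ ≤ 1) (hs : ‖s‖ ≤ 1) (n : ℕ) :
    ‖secondDividedPow n t s‖ ≤ 1 :=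
  IsUltrametricDist.norm_sum_le_of_forall_le_of_nonneg zero_le_one fun i _ =>
    norm_mul_le_of_le_one (norm_pow_le_one ht i) (norm_dividedPow_le ht hs _)

theorem norm_sub_sum_range_le {u : ℕ → K} {F : K → K}
    (hF : ∀ t, ‖t‖ ≤ 1 → HasSum (fun n => u n * t ^ n) (F t)) {ε : ℝ} {N : ℕ} (hε : 0 ≤ ε)
    (hN : ∀ n, N ≤ n → ‖u n‖ ≤ ε) {t : K} (ht : ‖t‖ ≤ 1) :
    ‖F t - ∑ n ∈ Finset.range N, u n * t ^ n‖ ≤ ε := by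
  have h := (hasSum_nat_add_iff' N).2 (hF t ht)
  exact norm_le_of_hasSum h hε fun n =>
    norm_mul_le_of_le_one (hN _ (Nat.le_add_left _ _)) (norm_pow_le_one ht _)

section Series

/-- The sum of the termwise derivative of the power series with coefficients `u`. -/
noncomputable def seriesDeriv (u : ℕ → K) (t : K) : K :=
  ∑' n, u n * (n * t ^ (n - 1))

/-- The divided difference of the power series with coefficients `u`. -/
noncomputable def seriesSlope (u : ℕ → K) (t s : K) : K :=
  ∑' n, u n * dividedPow n t s

variable [CompleteSpace K] {u : ℕ → K} (hu : Tendsto u atTop (𝓝 0))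
include hu

theorem hasSum_seriesDeriv {t : K} (ht : ‖t‖ ≤ 1) :
    HasSum (fun n => u n * (n * t ^ (n - 1))) (seriesDeriv u t) :=
  (summable_of_tendsto_zero (tendsto_mul_zero_of_norm_le_one hu fun n =>
    norm_mul_le_of_le_one (IsUltrametricDist.norm_natCast_le_one K n)
      (norm_pow_le_one ht _))).hasSum

theorem hasSum_seriesSlope {t s : K} (ht : ‖t‖ ≤ 1) (hs : ‖s‖ ≤ 1) :
    HasSum (fun n => u n * dividedPow n t s) (seriesSlope u t s) :=
  (summable_of_tendsto_zero (tendsto_mul_zero_of_norm_le_one hu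
    (norm_dividedPow_le ht hs))).hasSum

variable {F : K → K} (hF : ∀ t, ‖t‖ ≤ 1 → HasSum (fun n => u n * t ^ n) (F t))
include hF

theorem seriesSlope_mul_sub {t s : K} (ht : ‖t‖ ≤ 1) (hs : ‖s‖ ≤ 1) :
    seriesSlope u t s * (t - s) = F t - F s := by
  refine ((hasSum_seriesSlope hu ht hs).mul_right (t - s)).unique ?_
  refine ((hF t ht).sub (hF s hs)).congr_fun fun n => ?_
  rw [mul_assoc, dividedPow_mul_sub, mul_sub]

/-- Near `r` the series is linear with slope `F' r` up to a map with a small Lipschitz constant. -/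
theorem norm_sub_sub_seriesDeriv_le (hu1 : ∀ n, ‖u n‖ ≤ 1) {t s r : K} {ρ : ℝ}
    (ht : ‖t‖ ≤ 1) (hs : ‖s‖ ≤ 1) (hr : ‖r‖ ≤ 1) (hρ : 0 ≤ ρ)
    (htr : ‖t - r‖ ≤ ρ) (hsr : ‖s - r‖ ≤ ρ) :
    ‖F t - F s - seriesDeriv u r * (t - s)‖ ≤ ρ * ‖t - s‖ := by
  rw [← seriesSlope_mul_sub hu hF ht hs, ← sub_mul, norm_mul]
  refine mul_le_mul_of_nonneg_right ?_ (norm_nonneg _)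
  refine norm_le_of_hasSum ((hasSum_seriesSlope hu ht hs).sub (hasSum_seriesDeriv hu hr)) hρ
    fun n => ?_
  rw [← mul_sub, mul_comm]
  exact norm_mul_le_of_le_one (norm_dividedPow_sub_le ht hs hr hρ htr hsr n) (hu1 n)

/-- Closed discs are open, so the sum of a power series is differentiable at every point of the
closed disc, its rim included. -/
theorem hasDerivAt_of_hasSum (hu1 : ∀ n, ‖u n‖ ≤ 1) {r : K} (hr : ‖r‖ ≤ 1) :
    HasDerivAt F (seriesDeriv u r) r := by
  rw [hasDerivAt_iff_isLittleO]
  refine Asymptotics.IsBigO.trans_isLittleO (g := fun t => ‖t - r‖ ^ 2) ?_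
    (Asymptotics.isLittleO_pow_sub_sub r one_lt_two)
  refine Asymptotics.IsBigO.of_bound 1 ?_
  filter_upwards [Metric.closedBall_mem_nhds r one_pos] with t ht
  rw [mem_closedBall_iff_norm] at ht
  have ht1 : ‖t‖ ≤ 1 := by
    have : t = (t - r) + r := by ring
    rw [this]
    exact norm_add_le_of_le ht hr
  have := norm_sub_sub_seriesDeriv_le hu hF hu1 ht1 hr hr (norm_nonneg (t - r)) le_rfl (by simp)
  rw [one_mul, norm_pow, norm_norm, sq, smul_eq_mul, mul_comm (t - r)]
  exact this

end Series

/-! ### Power series that are bijections of the closed unit disc -/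

omit [IsUltrametricDist K] in
theorem norm_coeff_le_one_of_lt {u : ℕ → K} (h0 : u 0 = 0) (hu1 : ‖u 1‖ = 1)
    (hu2 : ∀ n, 2 ≤ n → ‖u n‖ < 1) (n : ℕ) : ‖u n‖ ≤ 1 := by
  rcases n with _ | _ | n
  · simp [h0]
  · exact hu1.le
  · exact (hu2 _ (by omega)).le

section Bijection

variable [CompleteSpace K] {u : ℕ → K} (hu : Tendsto u atTop (𝓝 0))
  {F : K → K} (hF : ∀ t, ‖t‖ ≤ 1 → HasSum (fun n => u n * t ^ n) (F t))
include hu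

theorem exists_norm_seriesSlope_sub_le (h2 : ∀ n, 2 ≤ n → ‖u n‖ < 1) :
    ∃ k, 0 ≤ k ∧ k < 1 ∧ ∀ t s, ‖t‖ ≤ 1 → ‖s‖ ≤ 1 → ‖seriesSlope u t s - u 1‖ ≤ k := by
  obtain ⟨k, hk0, hk1, hk⟩ := exists_lt_one_forall_norm_le hu h2
  refine ⟨k, hk0, hk1, fun t s ht hs => ?_⟩
  refine norm_le_of_hasSum ((hasSum_seriesSlope hu ht hs).sub (hasSum_ite_eq 1 (u 1))) hk0
    fun n => ?_
  rcases n with _ | _ | n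
  · simp [dividedPow, hk0]
  · simp [dividedPow, hk0]
  · rw [if_neg (by omega), sub_zero]
    exact norm_mul_le_of_le_one (hk _ (by omega)) (norm_dividedPow_le ht hs _)

/-- Fixing `0` and `1` forces the linear coefficient into the residue disc of `1`, so that the whole
series is a small perturbation of the identity. -/
theorem exists_norm_seriesSlope_sub_one_le {F : K → K}
    (hF : ∀ t, ‖t‖ ≤ 1 → HasSum (fun n => u n * t ^ n) (F t)) (h0 : u 0 = 0)
    (hu2 : ∀ n, 2 ≤ n → ‖u n‖ < 1) (hF1 : F 1 = 1) :
    ∃ k, 0 ≤ k ∧ k < 1 ∧ ∀ t s, ‖t‖ ≤ 1 → ‖s‖ ≤ 1 → ‖seriesSlope u t s - 1‖ ≤ k := by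
  obtain ⟨k, hk0, hk1, hk⟩ := exists_norm_seriesSlope_sub_le hu hu2
  refine ⟨k, hk0, hk1, fun t s ht hs => ?_⟩
  have h1 := hk 1 0 (by simp) (by simp)
  have h2 := seriesSlope_mul_sub hu hF (t := 1) (s := 0) (by simp) (by simp)
  rw [apply_zero_of_hasSum hF, h0, hF1, sub_zero, mul_one] at h2
  rw [h2] at h1
  have e : seriesSlope u t s - 1 = (seriesSlope u t s - u 1) - (1 - u 1) := by ring
  rw [e]
  exact norm_sub_le_of_le (hk t s ht hs) h1

include hF

theorem bijOn_of_coeff (h0 : u 0 = 0) (h1 : ‖u 1‖ = 1) (h2 : ∀ n, 2 ≤ n → ‖u n‖ < 1) :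
    Set.BijOn F (Metric.closedBall 0 1) (Metric.closedBall 0 1) := by
  obtain ⟨k, hk0, hk1, hk⟩ := exists_norm_seriesSlope_sub_le hu h2
  have hF0 : F 0 = 0 := (apply_zero_of_hasSum hF).trans h0
  have key : ∀ t s, ‖t‖ ≤ 1 → ‖s‖ ≤ 1 → ‖F t - F s - u 1 * (t - s)‖ ≤ k * ‖t - s‖ := by
    intro t s ht hs
    rw [← seriesSlope_mul_sub hu hF ht hs, ← sub_mul, norm_mul]
    exact mul_le_mul_of_nonneg_right (hk t s ht hs) (norm_nonneg _)
  have hiso : ∀ t s, ‖t‖ ≤ 1 → ‖s‖ ≤ 1 → ‖F t - F s‖ = ‖t - s‖ := by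
    intro t s ht hs
    rcases eq_or_ne t s with rfl | hne
    · simp
    · have hpos : 0 < ‖t - s‖ := norm_pos_iff.2 (sub_ne_zero.2 hne)
      have e : ‖u 1 * (t - s)‖ = ‖t - s‖ := by rw [norm_mul, h1, one_mul]
      rw [← e]
      refine norm_eq_of_norm_sub_lt ?_
      rw [norm_sub_rev, e]
      refine (key t s ht hs).trans_lt ?_
      nlinarith
  refine ⟨fun t ht => ?_, fun t ht s hs hts => ?_, fun y hy => ?_⟩
  · rw [mem_closedBall_zero_iff] at ht ⊢
    have := hiso t 0 ht (by simp)
    rw [hF0, sub_zero, sub_zero] at this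
    rwa [this]
  · rw [mem_closedBall_zero_iff] at ht hs
    have := hiso t s ht hs
    rw [hts, sub_self, norm_zero] at this
    exact sub_eq_zero.1 (norm_eq_zero.1 this.symm)
  · rw [mem_closedBall_zero_iff] at hy
    obtain ⟨t, ht, rfl⟩ := exists_preimage_of_approx (F := F) (c := u 1) (t₀ := 0) (y := y) (ρ := 1)
      hk0 (h1 ▸ hk1) zero_le_one
      (fun t s ht hs => key t s (by simpa using ht) (by simpa using hs))
      (by rw [hF0, h1, sub_zero, one_mul]; exact hy)
    exact ⟨t, by simpa using ht, rfl⟩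

variable [IsAlgClosed K] [CharZero K] {p : ℕ} (hp : 1 < p) (hpK : ‖(p : K)‖ < 1)
include hp hpK

omit hF in
/-- In characteristic zero the derivative of a power series with a nonzero coefficient of positive
index does not vanish identically. -/
theorem exists_seriesDeriv_ne_zero {d : ℕ} (hd : 1 ≤ d) (hud : u d ≠ 0) :
    ∃ t, ‖t‖ ≤ 1 ∧ seriesDeriv u t ≠ 0 := by
  by_contra! H
  have h : ∀ t, ‖t‖ = 1 → HasSum (fun n => (u (n + 1) * ((n + 1 : ℕ) : K)) * t ^ n)
      (seriesDeriv u t) := by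
    intro t ht
    have := (hasSum_nat_add_iff' 1).2 (hasSum_seriesDeriv hu ht.le)
    simp only [Finset.range_one, Finset.sum_singleton, Nat.cast_zero, zero_mul, mul_zero,
      sub_zero] at this
    refine this.congr_fun fun n => ?_
    rw [Nat.add_sub_cancel, mul_assoc]
  have h1 := norm_coeff_le_of_norm_eq_one hp hpK h (C := 0)
    (fun t ht => by rw [H t ht.le, norm_zero]) (d - 1)
  rw [Nat.sub_add_cancel hd] at h1
  have h2 := norm_le_zero_iff.1 h1
  rcases mul_eq_zero.1 h2 with h3 | h3
  · exact hud h3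
  · exact absurd h3 (by exact_mod_cast (by omega : d ≠ 0))

/-- A power series with coefficients in the closed unit disc and a coefficient of norm `1` of index
at least `2` is not injective on the closed unit disc. Around a point `t₀` where the derivative does
not vanish the series is a bijection between small discs. A truncation of the series takes its value
at `t₀` once more, at a point not too close to `t₀` (here the coefficient of index at least `2`
enters); the value of the series there is so close to the value at `t₀` that it is also taken in the
small disc around `t₀`. -/
theorem not_injOn_of_norm_coeff_eq_one (hu1 : ∀ n, ‖u n‖ ≤ 1) {d : ℕ} (hd : 2 ≤ d)
    (hud : ‖u d‖ = 1) : ¬ Set.InjOn F (Metric.closedBall 0 1) := by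
  intro hinj
  -- `d` is replaced by the largest index with a coefficient of norm `1`
  obtain ⟨d, hd, hud, hmax⟩ : ∃ d, 2 ≤ d ∧ ‖u d‖ = 1 ∧ ∀ n, d + 1 ≤ n → ‖u n‖ < 1 := by
    have h0 : ∀ᶠ n in atTop, ‖u n‖ < 1 := by
      have := hu.norm
      rw [norm_zero] at this
      exact this.eventually (gt_mem_nhds one_pos)
    obtain ⟨N, hN⟩ := eventually_atTop.1 h0
    have hdN : d ≤ N := by
      by_contra! h
      exact absurd (hN d h.le) (by rw [hud]; exact lt_irrefl _)
    set m := Nat.findGreatest (fun n => ‖u n‖ = 1) N with hm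
    refine ⟨m, hd.trans (Nat.le_findGreatest hdN hud), ?_, fun n hn => ?_⟩
    · exact Nat.findGreatest_spec (P := fun n => ‖u n‖ = 1) hdN hud
    · refine lt_of_le_of_ne (hu1 n) fun h => ?_
      rcases le_or_gt N n with h1 | h1
      · exact absurd h (hN n h1).ne
      · have := Nat.le_findGreatest (P := fun n => ‖u n‖ = 1) h1.le h
        omega
  obtain ⟨t₀, ht₀, hder⟩ := exists_seriesDeriv_ne_zero hu hp hpK (by omega : 1 ≤ d)
    (norm_pos_iff.1 (by rw [hud]; exact one_pos))
  set δ := ‖seriesDeriv u t₀‖ with hδ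
  have hδ0 : 0 < δ := norm_pos_iff.2 hder
  have hδ1 : δ ≤ 1 := norm_le_of_hasSum (hasSum_seriesDeriv hu ht₀) zero_le_one fun n =>
    norm_mul_le_of_le_one (hu1 n) (norm_mul_le_of_le_one
      (IsUltrametricDist.norm_natCast_le_one K n) (norm_pow_le_one ht₀ _))
  set ρ := δ / 2 with hρ
  have hρ0 : 0 < ρ := by positivity
  have hρδ : ρ < δ := by linarith
  obtain ⟨N₀, hN₀⟩ := eventually_atTop.1 (by
    have := hu.norm
    rw [norm_zero] at this
    exact this.eventually (gt_mem_nhds (by positivity : 0 < δ * ρ)))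
  set N := N₀ + d + 1 with hN
  have hNε : ∀ n, N ≤ n → ‖u n‖ ≤ δ * ρ := fun n hn => (hN₀ n (by omega)).le
  set P : K[X] := ∑ n ∈ Finset.range N, C (u n) * X ^ n with hP
  have hPc : ∀ n, P.coeff n = if n < N then u n else 0 := by
    intro n
    rw [hP, finsetSum_coeff]
    simp [coeff_X_pow]
  have hPe : ∀ t, P.eval t = ∑ n ∈ Finset.range N, u n * t ^ n := by
    intro t
    rw [hP, eval_finsetSum]
    simp
  have hFP : ∀ t, ‖t‖ ≤ 1 → ‖F t - P.eval t‖ ≤ δ * ρ := by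
    intro t ht
    rw [hPe]
    exact norm_sub_sum_range_le hF (by positivity) hNε ht
  have hPc1 : ∀ n, ‖P.coeff n‖ ≤ 1 := by
    intro n
    rw [hPc]
    split_ifs
    · exact hu1 n
    · simp
  set Q := taylor t₀ P with hQ
  have hQc : ∀ n, Q.coeff n
      = ∑ m ∈ Finset.range N, ((m + n).choose n : K) * P.coeff (m + n) * t₀ ^ m := by
    intro n
    rw [hQ, taylor_coeff, eval_eq_sum_range' (n := N)]
    · simp_rw [hasseDeriv_coeff]
    · have h1 : P.natDegree < N := by
        rw [Nat.lt_iff_add_one_le, hN, Nat.add_le_add_iff_right]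
        refine natDegree_le_iff_coeff_eq_zero.2 fun m hm => ?_
        rw [hPc, if_neg (by omega)]
      exact (natDegree_hasseDeriv_le P n).trans_lt (by omega)
  have hQ1 : ∀ n, ‖Q.coeff n‖ ≤ 1 := by
    intro n
    rw [hQc]
    refine IsUltrametricDist.norm_sum_le_of_forall_le_of_nonneg zero_le_one fun m _ => ?_
    exact norm_mul_le_of_le_one (norm_mul_le_of_le_one (IsUltrametricDist.norm_natCast_le_one K _)
      (hPc1 _)) (norm_pow_le_one ht₀ _)
  -- maximality of `d` keeps the coefficient of index `d` a unit under the translation to `t₀`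
  have hQd : ‖Q.coeff d‖ = 1 := by
    obtain ⟨k, hk0, hk1, hk⟩ := exists_lt_one_forall_norm_le hu hmax
    rw [← hud]
    refine norm_eq_of_norm_sub_lt ?_
    rw [hud, norm_sub_rev]
    refine lt_of_le_of_lt ?_ hk1
    rw [hQc, Finset.sum_range_succ']
    have e : P.coeff (0 + d) = u d := by rw [zero_add, hPc, if_pos (by omega)]
    rw [e, zero_add, Nat.choose_self, Nat.cast_one, one_mul, pow_zero, mul_one, add_sub_cancel_right]
    refine IsUltrametricDist.norm_sum_le_of_forall_le_of_nonneg hk0 fun m _ => ?_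
    refine norm_mul_le_of_le_one ?_ (norm_pow_le_one ht₀ _)
    rw [mul_comm]
    refine norm_mul_le_of_le_one ?_ (IsUltrametricDist.norm_natCast_le_one K _)
    rw [hPc]
    split_ifs
    · exact hk _ (by omega)
    · simpa using hk0
  have hQone : ‖Q.coeff 1‖ = δ := by
    rw [hδ]
    refine norm_eq_of_norm_sub_lt ?_
    have e : Q.coeff 1 = ∑ n ∈ Finset.range N, u n * (n * t₀ ^ (n - 1)) := by
      rw [hQ, taylor_coeff_one, hP, derivative_sum, eval_finsetSum]
      refine Finset.sum_congr rfl fun n _ => ?_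
      simp [derivative_X_pow]
    rw [e]
    refine lt_of_le_of_lt (norm_le_of_hasSum ((hasSum_nat_add_iff' N).2
      (hasSum_seriesDeriv hu ht₀)) (by positivity) fun n => ?_) (show δ * ρ < δ by nlinarith)
    exact norm_mul_le_of_le_one (hNε _ (Nat.le_add_left _ _)) (norm_mul_le_of_le_one
      (IsUltrametricDist.norm_natCast_le_one K _) (norm_pow_le_one ht₀ _))
  -- the second solution of `P = P t₀` is a zero of the slope polynomial `(Q - Q 0) / X`
  obtain ⟨h, hh1, hh⟩ := exists_root_norm_le_one (P := divX Q) (m := d - 1)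
    (fun n => by rw [coeff_divX]; exact hQ1 _) (by omega)
    (by rw [coeff_divX, Nat.sub_add_cancel (by omega)]; exact hQd)
  have hδh : δ ≤ ‖h‖ := by
    have e := congrArg (eval h) (divX_mul_X_add (divX Q))
    rw [eval_add, eval_mul, eval_X, eval_C, hh, coeff_divX, zero_add] at e
    have e2 : Q.coeff 1 = h * (-(divX (divX Q)).eval h) := by linear_combination e
    rw [← hQone, e2]
    refine norm_mul_le_of_le_one le_rfl ?_
    rw [norm_neg, eval_eq_sum_range]
    refine IsUltrametricDist.norm_sum_le_of_forall_le_of_nonneg zero_le_one fun m _ => ?_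
    rw [coeff_divX, coeff_divX]
    exact norm_mul_le_of_le_one (hQ1 _) (norm_pow_le_one hh1 _)
  have hPh : P.eval (h + t₀) = P.eval t₀ := by
    rw [← taylor_eval, ← hQ]
    have e := congrArg (eval h) (divX_mul_X_add Q)
    rw [eval_add, eval_mul, eval_X, eval_C, hh, zero_mul, zero_add] at e
    rw [← e, hQ, taylor_coeff_zero]
  have hht : ‖h + t₀‖ ≤ 1 := norm_add_le_of_le hh1 ht₀
  have hclose : ‖F (h + t₀) - F t₀‖ ≤ δ * ρ := by
    have e : F (h + t₀) - F t₀ = (F (h + t₀) - P.eval (h + t₀)) - (F t₀ - P.eval t₀) := by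
      rw [hPh]; ring
    rw [e]
    exact norm_sub_le_of_le (hFP _ hht) (hFP _ ht₀)
  have hin : ∀ t, ‖t - t₀‖ ≤ ρ → ‖t‖ ≤ 1 := by
    intro t ht
    have e : t = (t - t₀) + t₀ := by ring
    rw [e]
    exact norm_add_le_of_le (by linarith) ht₀
  obtain ⟨s, hs, hFs⟩ := exists_preimage_of_approx (F := F) (c := seriesDeriv u t₀) (t₀ := t₀)
    (y := F (h + t₀)) (k := ρ) (ρ := ρ) hρ0.le hρδ hρ0.le
    (fun t s ht hs => norm_sub_sub_seriesDeriv_le hu hF hu1 (hin t ht) (hin s hs) ht₀ hρ0.le ht hs)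
    hclose
  have := hinj (by simpa using hin s hs) (by simpa using hht) hFs
  rw [this, add_sub_cancel_right] at hs
  linarith

/-- The condition that the rim is reached replaces surjectivity. -/
theorem coeff_of_injOn (h0 : u 0 = 0) (hinj : Set.InjOn F (Metric.closedBall 0 1))
    (hmaps : ∀ t, ‖t‖ ≤ 1 → ‖F t‖ ≤ 1) (hrim : ∃ t, ‖t‖ ≤ 1 ∧ ‖F t‖ = 1) :
    ‖u 1‖ = 1 ∧ ∀ n, 2 ≤ n → ‖u n‖ < 1 := by
  have hu1 : ∀ n, ‖u n‖ ≤ 1 := norm_coeff_le_of_norm_eq_one hp hpK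
    (fun t ht => hF t ht.le) (fun t ht => hmaps t ht.le)
  have h2 : ∀ n, 2 ≤ n → ‖u n‖ < 1 := fun n hn =>
    lt_of_le_of_ne (hu1 n) fun h => not_injOn_of_norm_coeff_eq_one hu hF hp hpK hu1 hn h hinj
  refine ⟨?_, h2⟩
  by_contra h1
  have h1' : ‖u 1‖ < 1 := lt_of_le_of_ne (hu1 1) h1
  obtain ⟨k, hk0, hk1, hk⟩ := exists_lt_one_forall_norm_le hu (m := 0) fun n _ => by
    rcases n with _ | _ | n
    · simp [h0]
    · exact h1'
    · exact h2 _ (by omega)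
  obtain ⟨t, ht, hFt⟩ := hrim
  have := norm_le_of_hasSum (hF t ht) hk0 fun n =>
    norm_mul_le_of_le_one (hk n (Nat.zero_le n)) (norm_pow_le_one ht n)
  linarith

end Bijection

/-! ### Bijections between closed discs -/

omit [IsUltrametricDist K] in
theorem bijOn_affine (c : K) {κ : K} (hκ : κ ≠ 0) :
    Set.BijOn (fun τ => c + κ * τ) (Metric.closedBall 0 1) (Metric.closedBall c ‖κ‖) := by
  refine ⟨fun τ hτ => ?_, fun τ _ σ _ h => ?_, fun t ht => ⟨(t - c) / κ, ?_, ?_⟩⟩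
  · rw [mem_closedBall_zero_iff] at hτ
    rw [mem_closedBall_iff_norm, add_sub_cancel_left]
    exact norm_mul_le_of_le_one le_rfl hτ
  · exact mul_left_cancel₀ hκ (add_left_cancel h)
  · rw [mem_closedBall_iff_norm] at ht
    rw [mem_closedBall_zero_iff, norm_div]
    exact div_le_one_of_le₀ ht (norm_nonneg _)
  · simp only
    field_simp
    ring

omit [IsUltrametricDist K] in
theorem bijOn_affine_symm (c : K) {κ : K} (hκ : κ ≠ 0) :
    Set.BijOn (fun t => (t - c) / κ) (Metric.closedBall c ‖κ‖) (Metric.closedBall 0 1) := by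
  refine (bijOn_affine c hκ).symm ⟨fun t _ => ?_, fun τ _ => ?_⟩
  · simp only
    field_simp
    ring
  · simp only
    field_simp
    ring

/-- `x` read in the coordinates in which both discs are the closed unit disc. -/
def normalized (x : K → K) (c κ a β : K) (τ : K) : K :=
  (x (c + κ * τ) - a) / β

omit [IsUltrametricDist K] in
theorem bijOn_normalized_iff {x : K → K} {c κ a β : K} (hκ : κ ≠ 0) (hβ : β ≠ 0) :
    Set.BijOn (normalized x c κ a β) (Metric.closedBall 0 1) (Metric.closedBall 0 1) ↔
      Set.BijOn x (Metric.closedBall c ‖κ‖) (Metric.closedBall a ‖β‖) := by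
  constructor
  · intro h
    refine ((bijOn_affine a hβ).comp (h.comp (bijOn_affine_symm c hκ))).congr fun t _ => ?_
    simp only [Function.comp, normalized]
    rw [mul_div_cancel₀ _ hκ, mul_div_cancel₀ _ hβ]
    ring_nf
  · intro h
    exact (bijOn_affine_symm a hβ).comp (h.comp (bijOn_affine c hκ))

theorem hasSum_normalized {x : K → K} {c κ a β : K} {u : ℕ → K}
    (hx : ∀ t ∈ Metric.closedBall c ‖κ‖, HasSum (fun n => u n * (t - c) ^ n) (x t))
    (τ : K) (hτ : ‖τ‖ ≤ 1) :
    HasSum (fun n => (u n * κ ^ n - if n = 0 then a else 0) / β * τ ^ n)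
      (normalized x c κ a β τ) := by
  have h1 := hx (c + κ * τ) (by
    rw [mem_closedBall_iff_norm, add_sub_cancel_left]
    exact norm_mul_le_of_le_one le_rfl hτ)
  have h2 := (h1.sub (hasSum_ite_eq 0 a)).div_const β
  refine h2.congr_fun fun n => ?_
  rw [add_sub_cancel_left, mul_pow]
  rcases n with _ | n
  · simp
  · simp only [Nat.add_eq_zero_iff, one_ne_zero, and_false, if_false, sub_zero]
    ring

section

variable [IsAlgClosed K] [CharZero K] {p : ℕ} (hp : 1 < p) (hpK : ‖(p : K)‖ < 1)
include hp hpK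

theorem coeff_unique {u v : ℕ → K} {F : K → K}
    (hu : ∀ t, ‖t‖ ≤ 1 → HasSum (fun n => u n * t ^ n) (F t))
    (hv : ∀ t, ‖t‖ ≤ 1 → HasSum (fun n => v n * t ^ n) (F t)) : u = v := by
  funext n
  have h := norm_coeff_le_of_norm_eq_one hp hpK (u := fun n => u n - v n) (F := fun _ => 0) (C := 0)
    (fun t ht => by
      have := (hu t ht.le).sub (hv t ht.le)
      rw [sub_self] at this
      exact this.congr_fun fun n => sub_mul _ _ _)
    (fun t _ => by simp) n
  exact sub_eq_zero.1 (norm_le_zero_iff.1 h)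

/-- A point that is sent to the rim lies on the rim: in the interior, Cauchy's estimate on a slightly
larger circle gives a strictly smaller bound. -/
theorem norm_sub_eq_of_norm_apply_sub_eq {x : K → K} {c a b : K} {R r : ℝ} {u : ℕ → K}
    (hx : ∀ t ∈ Metric.closedBall c R, HasSum (fun n => u n * (t - c) ^ n) (x t))
    (hxc : x c = a) (hr : 0 < r)
    (hmaps : Set.MapsTo x (Metric.closedBall c R) (Metric.closedBall a r))
    (hb : b ∈ Metric.closedBall c R) (hxb : ‖x b - a‖ = r) : ‖b - c‖ = R := by
  rw [mem_closedBall_iff_norm] at hb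
  refine le_antisymm hb (not_lt.1 fun hlt => ?_)
  have hR : 0 < R := (norm_nonneg _).trans_lt hlt
  obtain ⟨z, hz, hz1⟩ := exists_norm_between (K := K) hp hpK ((div_lt_one hR).2 hlt)
  have hz0 : 0 < ‖z‖ := (div_nonneg (norm_nonneg _) hR.le).trans_lt hz
  have hzn : z ≠ 0 := norm_pos_iff.1 hz0
  set κ := (b - c) / z with hκ
  have hκR : ‖κ‖ ≤ R := by
    rw [hκ, norm_div, div_le_iff₀ hz0]
    rw [div_lt_iff₀ hR] at hz
    linarith
  have hxκ : ∀ t ∈ Metric.closedBall c ‖κ‖, HasSum (fun n => u n * (t - c) ^ n) (x t) :=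
    fun t ht => hx t (Metric.closedBall_subset_closedBall hκR ht)
  have hN := hasSum_normalized (a := a) (β := 1) hxκ
  set v : ℕ → K := fun n => (u n * κ ^ n - if n = 0 then a else 0) / 1 with hv
  have hv0 : v 0 = 0 := by
    rw [← apply_zero_of_hasSum (u := v) hN]
    simp [normalized, hxc]
  have hvr : ∀ n, ‖v n‖ ≤ r := norm_coeff_le_of_norm_eq_one hp hpK (fun t ht => hN t ht.le)
    fun t ht => by
      have := hmaps (x := c + κ * t) (by
        rw [mem_closedBall_iff_norm, add_sub_cancel_left, norm_mul, ht, mul_one]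
        exact hκR)
      rw [mem_closedBall_iff_norm] at this
      rwa [normalized, div_one]
  have h1 : ‖normalized x c κ a 1 z‖ ≤ r * ‖z‖ := by
    refine norm_le_of_hasSum (hN z hz1.le) (by positivity) fun n => ?_
    rcases n with _ | n
    · change ‖v 0 * z ^ 0‖ ≤ _
      rw [hv0, zero_mul, norm_zero]
      positivity
    · change ‖v (n + 1) * z ^ (n + 1)‖ ≤ _
      rw [norm_mul, pow_succ, norm_mul, mul_comm ‖z ^ n‖, ← mul_assoc]
      exact (mul_le_of_le_one_right (by positivity) (norm_pow_le_one hz1.le n)).trans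
        (mul_le_mul_of_nonneg_right (hvr _) hz0.le)
  have h2 : normalized x c κ a 1 z = x b - a := by
    rw [normalized, div_one, hκ, div_mul_cancel₀ _ hzn]
    ring_nf
  rw [h2, hxb] at h1
  nlinarith

variable [CompleteSpace K]

/-- The power series of a bijection between closed discs in normalized coordinates. -/
theorem exists_coeff_normalized {x : K → K} {c κ a β : K} {u : ℕ → K}
    (hx : ∀ t ∈ Metric.closedBall c ‖κ‖, HasSum (fun n => u n * (t - c) ^ n) (x t))
    (hxc : x c = a) (hκ : κ ≠ 0) (hβ : β ≠ 0) :
    ∃ v : ℕ → K, (∀ τ, ‖τ‖ ≤ 1 → HasSum (fun n => v n * τ ^ n) (normalized x c κ a β τ)) ∧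
      v 0 = 0 ∧ v 1 = u 1 * κ / β ∧
      (Set.BijOn x (Metric.closedBall c ‖κ‖) (Metric.closedBall a ‖β‖) ↔
        ‖v 1‖ = 1 ∧ ∀ n, 2 ≤ n → ‖v n‖ < 1) := by
  have hN := hasSum_normalized (a := a) (β := β) hx
  have hv := tendsto_coeff_zero (hN 1 (by simp))
  have hv1 : (u 1 * κ ^ 1 - if 1 = 0 then a else 0) / β = u 1 * κ / β := by simp
  set v : ℕ → K := fun n => (u n * κ ^ n - if n = 0 then a else 0) / β
  have h0 : v 0 = 0 := by
    rw [← apply_zero_of_hasSum (u := v) hN]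
    simp [normalized, hxc]
  refine ⟨v, hN, h0, hv1, ?_⟩
  rw [← bijOn_normalized_iff hκ hβ]
  constructor
  · intro h
    refine coeff_of_injOn hv hN hp hpK h0 h.injOn (fun t ht => ?_) ?_
    · simpa using h.mapsTo (by simpa using ht)
    · obtain ⟨t, ht, h1⟩ := h.surjOn (show (1 : K) ∈ Metric.closedBall 0 1 by simp)
      exact ⟨t, by simpa using ht, by rw [h1, norm_one]⟩
  · rintro ⟨h1, h2⟩
    exact bijOn_of_coeff hv hN h0 h1 h2

/-- The two conditions are both equivalent to the condition on the normalized coefficients in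
`exists_coeff_normalized`. In each case the radius `R` is shown to be the norm of an element, so that
normalized coordinates exist. -/
theorem bijOn_closedBall_iff {x : K → K} {c a β : K} {R : ℝ} {u : ℕ → K}
    (hx : ∀ t ∈ Metric.closedBall c R, HasSum (fun n => u n * (t - c) ^ n) (x t))
    (hxc : x c = a) (hR : 0 < R) (hβ : β ≠ 0) :
    Set.BijOn x (Metric.closedBall c R) (Metric.closedBall a ‖β‖) ↔
      ∃ (γ : K) (g : K → K), ‖γ‖ = ‖β‖ / R ∧
        (∃ w : ℕ → K, ∀ t ∈ Metric.closedBall c R, HasSum (fun n => w n * (t - c) ^ n) (g t)) ∧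
        (∃ s < ‖β‖, ∀ t ∈ Metric.closedBall c R, ‖g t‖ ≤ s) ∧
        ∀ t ∈ Metric.closedBall c R, x t = a + γ * (t - c) + g t := by
  have hβ0 : 0 < ‖β‖ := norm_pos_iff.2 hβ
  constructor
  · intro hbij
    obtain ⟨b, hb, hxb⟩ := hbij.surjOn (show a + β ∈ Metric.closedBall a ‖β‖ by simp)
    have hbR : ‖b - c‖ = R := norm_sub_eq_of_norm_apply_sub_eq hp hpK hx hxc hβ0 hbij.mapsTo hb
      (by rw [hxb, add_sub_cancel_left])
    subst hbR
    have hκ : b - c ≠ 0 := norm_pos_iff.1 hR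
    set κ := b - c
    clear_value κ
    obtain ⟨v, hv, hv0, hv1, hiff⟩ := exists_coeff_normalized hp hpK hx hxc hκ hβ
    obtain ⟨h1, h2⟩ := hiff.1 hbij
    have hvt := tendsto_coeff_zero (hv 1 (by simp))
    obtain ⟨k, hk0, hk1, hk⟩ := exists_norm_seriesSlope_sub_le hvt h2
    refine ⟨u 1, fun t => x t - a - u 1 * (t - c), ?_,
      ⟨fun n => u n - (if n = 0 then a else 0) - if n = 1 then u 1 else 0, fun t ht => ?_⟩,
      ⟨k * ‖β‖, by nlinarith, fun t ht => ?_⟩, fun t _ => by ring⟩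
    · rw [hv1, norm_div, norm_mul, div_eq_one_iff_eq hβ0.ne'] at h1
      rw [eq_div_iff hR.ne', h1]
    · refine (((hx t ht).sub (hasSum_ite_eq 0 a)).sub
        (hasSum_ite_eq 1 (u 1 * (t - c)))).congr_fun fun n => ?_
      rcases n with _ | _ | n <;> simp
    · obtain ⟨τ, hτ, rfl⟩ := (bijOn_affine c hκ).surjOn ht
      rw [mem_closedBall_zero_iff] at hτ
      have e := seriesSlope_mul_sub hvt hv hτ (s := 0) (by simp)
      rw [apply_zero_of_hasSum hv, hv0, sub_zero, sub_zero, normalized] at e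
      have e2 : x (c + κ * τ) - a - u 1 * (c + κ * τ - c)
          = β * ((seriesSlope v τ 0 - v 1) * τ) := by
        rw [sub_mul, e, hv1]
        field_simp
        ring
      simp only
      rw [e2, mul_comm β, norm_mul]
      exact mul_le_mul_of_nonneg_right
        (norm_mul_le_of_le_one (hk τ 0 hτ (by simp)) hτ) (norm_nonneg _)
  · rintro ⟨γ, g, hγ, ⟨w, hw⟩, ⟨s, hs, hgs⟩, hxg⟩
    have hγ0 : γ ≠ 0 := norm_pos_iff.1 (by rw [hγ]; positivity)
    have hκ : β / γ ≠ 0 := div_ne_zero hβ hγ0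
    have hκR : ‖β / γ‖ = R := by
      rw [norm_div, hγ]
      field_simp
    have hγκ : γ * (β / γ) = β := mul_div_cancel₀ _ hγ0
    set κ := β / γ
    rw [← hκR] at hx hw hgs hxg ⊢
    obtain ⟨v, hv, hv0, hv1, hiff⟩ := exists_coeff_normalized hp hpK hx hxc hκ hβ
    rw [hiff]
    have hG := hasSum_normalized (a := 0) (β := β) hw
    set w' : ℕ → K := fun n => (w n * κ ^ n - if n = 0 then 0 else 0) / β
    have hw' : ∀ n, ‖w' n‖ ≤ s / ‖β‖ := norm_coeff_le_of_norm_eq_one hp hpK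
      (fun t ht => hG t ht.le) fun t ht => by
        rw [normalized, sub_zero, norm_div]
        refine div_le_div_of_nonneg_right (hgs _ ?_) hβ0.le
        rw [mem_closedBall_iff_norm, add_sub_cancel_left, norm_mul, ht, mul_one]
    have hw1 : ∀ n, ‖w' n‖ < 1 := fun n => (hw' n).trans_lt ((div_lt_one hβ0).2 hs)
    have hvw : v = fun n => (if n = 1 then 1 else 0) + w' n := by
      refine coeff_unique hp hpK hv fun τ hτ => ?_
      have e : normalized x c κ a β τ = τ + normalized g c κ 0 β τ := by
        rw [normalized, normalized, hxg _ (by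
          rw [mem_closedBall_iff_norm, add_sub_cancel_left]
          exact norm_mul_le_of_le_one le_rfl hτ), add_sub_cancel_left, ← mul_assoc, hγκ]
        field_simp
        ring
      rw [e]
      refine ((hasSum_ite_eq 1 τ).add (hG τ hτ)).congr_fun fun n => ?_
      rcases n with _ | _ | n <;> simp [w', add_mul]
    constructor
    · rw [hvw]
      simp only [if_true]
      have : ‖(1 : K) - (1 + w' 1)‖ < ‖(1 : K)‖ := by
        rw [sub_add_cancel_left, norm_neg, norm_one]
        exact hw1 1
      rw [norm_eq_of_norm_sub_lt this, norm_one]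
    · intro n hn
      rw [hvw]
      simp only [if_neg (by omega : ¬ n = 1), zero_add]
      exact hw1 n

end

/-! ### Raising to `p`-power exponents -/

section Frobenius

variable {p : ℕ} (hp : p.Prime) (hpK : ‖(p : K)‖ < 1)
include hp

theorem norm_add_pow_sub_le {x y : K} (hx : ‖x‖ ≤ 1) (hy : ‖y‖ ≤ 1) :
    ‖(x + y) ^ p - x ^ p - y ^ p‖ ≤ ‖(p : K)‖ * ‖y‖ := by
  rw [add_pow_prime_eq hp]
  set T := ∑ k ∈ Finset.Ioo 0 p, x ^ (k - 1) * y ^ (p - k - 1) * ((p.choose k / p : ℕ) : K)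
  have hT : ‖T‖ ≤ 1 := IsUltrametricDist.norm_sum_le_of_forall_le_of_nonneg zero_le_one fun k _ =>
    norm_mul_le_of_le_one (norm_mul_le_of_le_one (norm_pow_le_one hx _) (norm_pow_le_one hy _))
      (IsUltrametricDist.norm_natCast_le_one K _)
  have e : x ^ p + y ^ p + p * x * y * T - x ^ p - y ^ p = (p * y) * (x * T) := by ring
  rw [e, ← norm_mul]
  exact norm_mul_le_of_le_one le_rfl (norm_mul_le_of_le_one hx hT)

/-- Taking `p`-th powers contracts distances less than `1`. -/
theorem norm_pow_sub_pow_prime_le {x y : K} {θ : ℝ} (hx : ‖x‖ ≤ 1) (hy : ‖y‖ ≤ 1)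
    (hpθ : ‖(p : K)‖ ≤ θ) (hxy : ‖x - y‖ ≤ θ) : ‖x ^ p - y ^ p‖ ≤ θ * ‖x - y‖ := by
  have hd : ‖x - y‖ ≤ 1 := norm_sub_le_of_le hx hy
  have h1 := norm_add_pow_sub_le hp hy hd
  rw [add_sub_cancel] at h1
  have e : x ^ p - y ^ p = (x ^ p - y ^ p - (x - y) ^ p) + (x - y) ^ p := by ring
  rw [e]
  refine norm_add_le_of_le (h1.trans (mul_le_mul_of_nonneg_right hpθ (norm_nonneg _))) ?_
  have h2 : (x - y) ^ p = (x - y) ^ (p - 2) * (x - y) * (x - y) := by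
    rw [← pow_succ, ← pow_succ]
    congr 1
    have := hp.two_le
    omega
  rw [h2, norm_mul, norm_mul]
  refine mul_le_mul_of_nonneg_right ?_ (norm_nonneg _)
  exact (mul_le_of_le_one_left (norm_nonneg _) (norm_pow_le_one hd _)).trans hxy

include hpK

theorem norm_pow_sub_pow_prime_lt_one_iff {x y : K} (hx : ‖x‖ ≤ 1) (hy : ‖y‖ ≤ 1) :
    ‖x ^ p - y ^ p‖ < 1 ↔ ‖x - y‖ < 1 := by
  have hd : ‖x - y‖ ≤ 1 := norm_sub_le_of_le hx hy
  have h1 := norm_add_pow_sub_le hp hy hd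
  rw [add_sub_cancel] at h1
  have h1' : ‖x ^ p - y ^ p - (x - y) ^ p‖ < 1 :=
    (h1.trans (mul_le_of_le_one_right (norm_nonneg _) hd)).trans_lt hpK
  have h2 : ‖(x - y) ^ p‖ < 1 ↔ ‖x - y‖ < 1 := by
    rw [norm_pow]
    exact pow_lt_one_iff_of_nonneg (norm_nonneg _) hp.ne_zero
  rw [← h2]
  constructor
  · intro h
    have e : (x - y) ^ p = (x ^ p - y ^ p) - (x ^ p - y ^ p - (x - y) ^ p) := by ring
    rw [e]
    exact norm_sub_lt_of_lt h h1'
  · intro h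
    have e : x ^ p - y ^ p = (x ^ p - y ^ p - (x - y) ^ p) + (x - y) ^ p := by ring
    rw [e]
    exact norm_add_lt_of_lt h1' h

/-- The `p`-power Frobenius of the residue field is injective. -/
theorem norm_pow_sub_pow_lt_one_iff {x y : K} (hx : ‖x‖ ≤ 1) (hy : ‖y‖ ≤ 1) (N : ℕ) :
    ‖x ^ p ^ N - y ^ p ^ N‖ < 1 ↔ ‖x - y‖ < 1 := by
  induction N with
  | zero => simp
  | succ N ih =>
    rw [pow_succ, pow_mul, pow_mul, ← ih]
    exact norm_pow_sub_pow_prime_lt_one_iff hp hpK (norm_pow_le_one hx _) (norm_pow_le_one hy _)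

theorem tendsto_pow_sub_pow {x y : K} (hx : ‖x‖ ≤ 1) (hy : ‖y‖ ≤ 1) (hxy : ‖x - y‖ < 1) :
    Tendsto (fun N : ℕ => x ^ p ^ N - y ^ p ^ N) atTop (𝓝 0) := by
  set θ := max ‖(p : K)‖ ‖x - y‖ with hθ
  have hθ0 : 0 ≤ θ := (norm_nonneg _).trans (le_max_left _ _)
  have hθ1 : θ < 1 := max_lt hpK hxy
  have key : ∀ N : ℕ, ‖x ^ p ^ N - y ^ p ^ N‖ ≤ θ ^ N * θ := by
    intro N
    induction N with
    | zero => simp [hθ]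
    | succ N ih =>
      rw [pow_succ, pow_mul, pow_mul, pow_succ θ]
      have h1 : θ ^ N * θ ≤ θ := mul_le_of_le_one_left hθ0 (pow_le_one₀ hθ0 hθ1.le)
      refine (norm_pow_sub_pow_prime_le hp (norm_pow_le_one hx _) (norm_pow_le_one hy _)
        (le_max_left _ _) (ih.trans h1)).trans ?_
      nlinarith
  refine squeeze_zero_norm key ?_
  simpa using (tendsto_pow_atTop_nhds_zero_of_lt_one hθ0 hθ1).mul_const θ

theorem norm_sub_one_lt_of_mem {N : ℕ} {ζ : K} (hζ : ζ ∈ nthRootsFinset (p ^ N) (1 : K)) :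
    ‖ζ - 1‖ < 1 := by
  have hM : 0 < p ^ N := pow_pos hp.pos N
  refine (norm_pow_sub_pow_lt_one_iff hp hpK (norm_eq_one_of_mem_nthRootsFinset hM hζ).le
    (by simp) N).1 ?_
  rw [(mem_nthRootsFinset hM 1).1 hζ, one_pow, sub_self, norm_zero]
  exact one_pos

theorem mem_ball_of_mem {N : ℕ} {ζ : K} (hζ : ζ ∈ nthRootsFinset (p ^ N) (1 : K)) :
    ζ ∈ Metric.ball (1 : K) 1 :=
  mem_ball_iff_norm.2 (norm_sub_one_lt_of_mem hp hpK hζ)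

end Frobenius

/-! ### The normalized arc sums -/

/-- The arc sum of `F` in the coordinate in which the arc is `𝒜(0, 1)`. -/
noncomputable def rootMean (p N : ℕ) (F : K → K) : K :=
  ((p : K) ^ N)⁻¹ * ∑ ζ ∈ nthRootsFinset (p ^ N) (1 : K), ζ * F ζ

section RootMean

variable {p : ℕ}

omit [IsUltrametricDist K] in
theorem rootMean_add (N : ℕ) (F G : K → K) :
    rootMean p N (F + G) = rootMean p N F + rootMean p N G := by
  simp only [rootMean, Pi.add_apply, mul_add, Finset.sum_add_distrib]

omit [IsUltrametricDist K] in
theorem rootMean_smul (N : ℕ) (c : K) (F : K → K) :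
    rootMean p N (c • F) = c * rootMean p N F := by
  simp only [rootMean, Pi.smul_apply, smul_eq_mul, Finset.mul_sum]
  exact Finset.sum_congr rfl fun ζ _ => by ring

omit [IsUltrametricDist K] in
theorem rootMean_sub (N : ℕ) (F G : K → K) :
    rootMean p N (F - G) = rootMean p N F - rootMean p N G := by
  simp only [rootMean, Pi.sub_apply, mul_sub, Finset.sum_sub_distrib]

variable (hp : p.Prime) (hpK : ‖(p : K)‖ < 1)
include hp

include hpK in
theorem rootMean_congr (N : ℕ) {F G : K → K} (h : ∀ t ∈ Metric.ball (1 : K) 1, F t = G t) :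
    rootMean p N F = rootMean p N G := by
  rw [rootMean, rootMean, Finset.sum_congr rfl]
  intro ζ hζ
  rw [h ζ (mem_ball_of_mem hp hpK hζ)]

include hpK in
/-- The trivial bound; unlike `norm_rootMean_le_of_hasSum` it is not uniform in `N`. -/
theorem norm_rootMean_le_mul (N : ℕ) {F : K → K} {C : ℝ} (hC : 0 ≤ C)
    (h : ∀ t ∈ Metric.ball (1 : K) 1, ‖F t‖ ≤ C) :
    ‖rootMean p N F‖ ≤ ‖((p : K) ^ N)⁻¹‖ * C := by
  rw [rootMean, norm_mul]
  refine mul_le_mul_of_nonneg_left ?_ (norm_nonneg _)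
  refine IsUltrametricDist.norm_sum_le_of_forall_le_of_nonneg hC fun ζ hζ => ?_
  rw [norm_mul, norm_eq_one_of_mem_nthRootsFinset (pow_pos hp.pos N) hζ, one_mul]
  exact h ζ (mem_ball_of_mem hp hpK hζ)

variable [IsAlgClosed K] [CharZero K]

omit [IsUltrametricDist K] [IsAlgClosed K] in
theorem natCast_pow_ne_zero (N : ℕ) : (p : K) ^ N ≠ 0 :=
  pow_ne_zero _ (by exact_mod_cast hp.ne_zero)

omit [IsUltrametricDist K] in
theorem rootMean_pow (N n : ℕ) :
    rootMean p N (fun t : K => t ^ n) = if p ^ N ∣ n + 1 then 1 else 0 := by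
  have h : ∀ ζ : K, ζ * ζ ^ n = ζ ^ (n + 1) := fun ζ => by ring
  simp only [rootMean, h, sum_nthRootsFinset_pow (pow_pos hp.pos N)]
  split_ifs
  · rw [Nat.cast_pow, inv_mul_cancel₀ (natCast_pow_ne_zero hp N)]
  · rw [mul_zero]

/-- The arc sums of `(t - 1) ^ n` are integers. -/
theorem norm_rootMean_sub_one_pow_le (N n : ℕ) : ‖rootMean p N (fun t : K => (t - 1) ^ n)‖ ≤ 1 := by
  have e : (fun t : K => (t - 1) ^ n) = ∑ m ∈ Finset.range (n + 1),
      ((-1 : K) ^ (n - m) * (n.choose m : K)) • fun t : K => t ^ m := by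
    funext t
    rw [sub_eq_add_neg, add_pow, Finset.sum_apply]
    refine Finset.sum_congr rfl fun m _ => ?_
    rw [Pi.smul_apply, smul_eq_mul]
    ring
  have h : ∀ s : Finset ℕ, ‖rootMean p N (∑ m ∈ s,
      ((-1 : K) ^ (n - m) * (n.choose m : K)) • fun t : K => t ^ m)‖ ≤ 1 := by
    intro s
    induction s using Finset.induction_on with
    | empty => simp [rootMean]
    | insert m s hm ih =>
      rw [Finset.sum_insert hm, rootMean_add, rootMean_smul, rootMean_pow hp]
      refine norm_add_le_of_le (norm_mul_le_of_le_one (norm_mul_le_of_le_one ?_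
        (IsUltrametricDist.norm_natCast_le_one K _)) ?_) ih
      · exact norm_pow_le_one (by simp) _
      · split_ifs <;> simp
  rw [e]
  exact h _

include hpK

/-- On bounded power series at `1` the arc sums are bounded by the sup norm, uniformly in `N`: the
factor `p ^ (-N)` is compensated since the arc sums of `(t - 1) ^ n` are integers. -/
theorem norm_rootMean_le_of_hasSum (N : ℕ) {F : K → K} {c : ℕ → K} {C : ℝ} (hC : 0 ≤ C)
    (hF : ∀ t ∈ Metric.ball (1 : K) 1, HasSum (fun n => c n * (t - 1) ^ n) (F t))
    (hb : ∀ t ∈ Metric.ball (1 : K) 1, ‖F t‖ ≤ C) : ‖rootMean p N F‖ ≤ C := by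
  have hc : ∀ n, ‖c n‖ ≤ C := by
    intro n
    have h1 : ∀ z : K, ‖z‖ < 1 → ‖c n‖ * ‖z‖ ^ n ≤ C := by
      intro z hz
      have hm : ∀ t : K, ‖t‖ = ‖z‖ → t + 1 ∈ Metric.ball (1 : K) 1 := fun t ht => by
        rw [mem_ball_iff_norm, add_sub_cancel_right, ht]
        exact hz
      exact norm_coeff_mul_pow_le hp.one_lt hpK (F := fun t => F (t + 1)) z
        (fun t ht => by simpa using hF _ (hm t ht)) (fun t ht => hb _ (hm t ht)) n
    by_contra! hlt
    have hcont : Tendsto (fun r : ℝ => ‖c n‖ * r ^ n) (𝓝[<] 1) (𝓝 (‖c n‖ * 1 ^ n)) :=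
      ((continuous_const.mul (continuous_pow n)).tendsto 1).mono_left nhdsWithin_le_nhds
    rw [one_pow, mul_one] at hcont
    have hev := hcont.eventually (lt_mem_nhds hlt)
    obtain ⟨r, hr1, hr⟩ := (mem_nhdsLT_iff_exists_Ioo_subset).1 hev
    obtain ⟨z, hz, hz1⟩ := exists_norm_between (K := K) hp.one_lt hpK hr1
    exact absurd (h1 z hz1) (not_le.2 (hr ⟨hz, hz1⟩))
  have h2 : HasSum (fun n => c n * rootMean p N (fun t : K => (t - 1) ^ n)) (rootMean p N F) := by
    have := (hasSum_sum (s := nthRootsFinset (p ^ N) (1 : K)) (fun ζ hζ =>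
      (hF ζ (mem_ball_of_mem hp hpK hζ)).mul_left ζ)).mul_left (((p : K) ^ N)⁻¹)
    refine this.congr_fun fun n => ?_
    rw [rootMean, mul_left_comm, Finset.mul_sum (a := c n)]
    congr 1
    exact Finset.sum_congr rfl fun ζ _ => by ring
  exact norm_le_of_hasSum h2 hC fun n =>
    norm_mul_le_of_le_one (hc n) (norm_rootMean_sub_one_pow_le hp N n)

omit hpK [IsUltrametricDist K] in
/-- Since `ζ ^ p ^ N = 1`, the quotient `ζ / (ζ - c)` is a polynomial in `ζ` divided by `1 - c ^ p ^ N`,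
and the sum over the roots of unity keeps one monomial. -/
theorem rootMean_inv_sub (N : ℕ) {c : K} (hc : c ^ p ^ N ≠ 1) :
    rootMean p N (fun t : K => (t - c)⁻¹) = (1 - c ^ p ^ N)⁻¹ := by
  have hM : 0 < p ^ N := pow_pos hp.pos N
  have hc' : 1 - c ^ p ^ N ≠ 0 := sub_ne_zero.2 hc.symm
  have h1 : ∀ ζ ∈ nthRootsFinset (p ^ N) (1 : K), ζ * (ζ - c)⁻¹
      = (1 - c ^ p ^ N)⁻¹ * ∑ i ∈ Finset.range (p ^ N), ζ ^ (i + 1) * c ^ (p ^ N - 1 - i) := by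
    intro ζ hζ
    have h2 := (mem_nthRootsFinset hM 1).1 hζ
    have hne : ζ - c ≠ 0 := by
      intro h
      rw [sub_eq_zero.1 h] at h2
      exact hc h2
    have h3 := geom_sum₂_mul ζ c (p ^ N)
    rw [h2] at h3
    rw [← h3] at hc' ⊢
    have h4 : ∑ i ∈ Finset.range (p ^ N), ζ ^ (i + 1) * c ^ (p ^ N - 1 - i)
        = ζ * ∑ i ∈ Finset.range (p ^ N), ζ ^ i * c ^ (p ^ N - 1 - i) := by
      rw [Finset.mul_sum]
      exact Finset.sum_congr rfl fun i _ => by ring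
    have h5 := left_ne_zero_of_mul hc'
    rw [h4]
    field_simp
  rw [rootMean, Finset.sum_congr rfl h1, ← Finset.mul_sum, Finset.sum_comm]
  have h6 : ∑ i ∈ Finset.range (p ^ N), ∑ ζ ∈ nthRootsFinset (p ^ N) (1 : K),
      ζ ^ (i + 1) * c ^ (p ^ N - 1 - i) = (p : K) ^ N := by
    simp_rw [← Finset.sum_mul, sum_nthRootsFinset_pow hM]
    rw [Finset.sum_eq_single (p ^ N - 1)]
    · rw [Nat.sub_add_cancel hM, if_pos dvd_rfl, Nat.sub_self, pow_zero, mul_one, Nat.cast_pow]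
    · intro i hi hne
      rw [Finset.mem_range] at hi
      rw [if_neg, zero_mul]
      intro hd
      have := Nat.le_of_dvd (Nat.succ_pos i) hd
      omega
    · intro h
      exact absurd (Finset.mem_range.2 (by omega)) h
  rw [h6, mul_comm, mul_assoc, mul_inv_cancel₀ (natCast_pow_ne_zero hp N), mul_one]

end RootMean

/-! ### Uniform closures of spaces of functions -/

/-- The functions that are uniform limits on `D` of elements of `V`. -/
def uniformClosure (V : Submodule K (K → K)) (D : Set K) : Submodule K (K → K) where
  carrier := {F | ∀ ε : ℝ, 0 < ε → ∃ G ∈ V, ∀ t ∈ D, ‖F t - G t‖ ≤ ε}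
  zero_mem' := fun ε hε => ⟨0, V.zero_mem, fun t _ => by simpa using hε.le⟩
  add_mem' := by
    intro F G hF hG ε hε
    obtain ⟨F', hF', h1⟩ := hF ε hε
    obtain ⟨G', hG', h2⟩ := hG ε hε
    refine ⟨F' + G', V.add_mem hF' hG', fun t ht => ?_⟩
    rw [Pi.add_apply, Pi.add_apply, add_sub_add_comm]
    exact norm_add_le_of_le (h1 t ht) (h2 t ht)
  smul_mem' := by
    intro c F hF ε hε
    have hc : 0 < ‖c‖ + 1 := by positivity
    obtain ⟨F', hF', h1⟩ := hF (ε / (‖c‖ + 1)) (by positivity)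
    refine ⟨c • F', V.smul_mem c hF', fun t ht => ?_⟩
    rw [Pi.smul_apply, Pi.smul_apply, ← smul_sub, norm_smul]
    calc ‖c‖ * ‖F t - F' t‖ ≤ (‖c‖ + 1) * (ε / (‖c‖ + 1)) :=
          mul_le_mul (by linarith) (h1 t ht) (norm_nonneg _) hc.le
      _ = ε := mul_div_cancel₀ _ hc.ne'

section UniformClosure

variable {V W : Submodule K (K → K)} {D D' : Set K}

theorem le_uniformClosure : V ≤ uniformClosure V D :=
  fun F hF ε hε => ⟨F, hF, fun t _ => by simpa using hε.le⟩

theorem uniformClosure_mono (hVW : V ≤ W) (hD : D' ⊆ D) :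
    uniformClosure V D ≤ uniformClosure W D' := fun F hF ε hε => by
  obtain ⟨G, hG, h⟩ := hF ε hε
  exact ⟨G, hVW hG, fun t ht => h t (hD ht)⟩

theorem mem_uniformClosure_of_approx {F : K → K}
    (h : ∀ ε : ℝ, 0 < ε → ∃ G ∈ uniformClosure V D, ∀ t ∈ D, ‖F t - G t‖ ≤ ε) :
    F ∈ uniformClosure V D := fun ε hε => by
  obtain ⟨G, hG, h1⟩ := h ε hε
  obtain ⟨G', hG', h2⟩ := hG ε hε
  refine ⟨G', hG', fun t ht => ?_⟩
  rw [← sub_add_sub_cancel (F t) (G t)]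
  exact norm_add_le_of_le (h1 t ht) (h2 t ht)

theorem mem_uniformClosure_congr {F G : K → K} (hG : G ∈ uniformClosure V D)
    (h : ∀ t ∈ D, F t = G t) : F ∈ uniformClosure V D :=
  mem_uniformClosure_of_approx fun ε hε => ⟨G, hG, fun t ht => by simpa [h t ht] using hε.le⟩

theorem exists_bound_of_mem_uniformClosure (hV : ∀ G ∈ V, ∃ C : ℝ, ∀ t ∈ D, ‖G t‖ ≤ C) {F : K → K}
    (hF : F ∈ uniformClosure V D) : ∃ C : ℝ, 0 ≤ C ∧ ∀ t ∈ D, ‖F t‖ ≤ C := by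
  obtain ⟨G, hG, h1⟩ := hF 1 one_pos
  obtain ⟨C, hC⟩ := hV G hG
  refine ⟨max C 1, zero_le_one.trans (le_max_right _ _), fun t ht => ?_⟩
  rw [← sub_add_cancel (F t) (G t)]
  exact norm_add_le_of_le ((h1 t ht).trans (le_max_right _ _)) ((hC t ht).trans (le_max_left _ _))

/-- A uniform closure is closed under products as soon as the products of elements of `V` lie in it and the
elements of `V` are bounded. -/
theorem mul_mem_uniformClosure (hV : ∀ G ∈ V, ∃ C : ℝ, ∀ t ∈ D, ‖G t‖ ≤ C)
    (hVV : ∀ F ∈ V, ∀ G ∈ V, F * G ∈ uniformClosure V D) {F G : K → K}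
    (hF : F ∈ uniformClosure V D) (hG : G ∈ uniformClosure V D) :
    F * G ∈ uniformClosure V D := by
  refine mem_uniformClosure_of_approx fun ε hε => ?_
  obtain ⟨C, hC0, hC⟩ := exists_bound_of_mem_uniformClosure hV hF
  obtain ⟨G', hG', h1⟩ := hG (ε / (C + 1)) (by positivity)
  obtain ⟨C', hC'0, hC'⟩ := exists_bound_of_mem_uniformClosure hV (le_uniformClosure (D := D) hG')
  obtain ⟨F', hF', h2⟩ := hF (ε / (C' + 1)) (by positivity)
  refine ⟨F' * G', hVV F' hF' G' hG', fun t ht => ?_⟩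
  have e : (F * G) t - (F' * G') t = F t * (G t - G' t) + (F t - F' t) * G' t := by
    simp only [Pi.mul_apply]
    ring
  rw [e]
  refine norm_add_le_of_le ?_ ?_
  · rw [norm_mul]
    calc ‖F t‖ * ‖G t - G' t‖ ≤ (C + 1) * (ε / (C + 1)) :=
          mul_le_mul (by linarith [hC t ht]) (h1 t ht) (norm_nonneg _) (by positivity)
      _ = ε := mul_div_cancel₀ _ (by positivity)
  · rw [norm_mul, mul_comm]
    calc ‖G' t‖ * ‖F t - F' t‖ ≤ (C' + 1) * (ε / (C' + 1)) :=
          mul_le_mul (by linarith [hC' t ht]) (h2 t ht) (norm_nonneg _) (by positivity)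
      _ = ε := mul_div_cancel₀ _ (by positivity)

theorem pow_mem_uniformClosure (h1 : (1 : K → K) ∈ uniformClosure V D)
    (hmul : ∀ F ∈ uniformClosure V D, ∀ G ∈ uniformClosure V D, F * G ∈ uniformClosure V D)
    {F : K → K} (hF : F ∈ uniformClosure V D) (n : ℕ) : F ^ n ∈ uniformClosure V D := by
  induction n with
  | zero => rwa [pow_zero]
  | succ n ih => rw [pow_succ]; exact hmul _ ih _ hF

theorem inv_one_sub_mem_uniformClosure (h1 : (1 : K → K) ∈ uniformClosure V D)
    (hmul : ∀ F ∈ uniformClosure V D, ∀ G ∈ uniformClosure V D, F * G ∈ uniformClosure V D)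
    {F : K → K} (hF : F ∈ uniformClosure V D) {k : ℝ} (hk1 : k < 1)
    (hFk : ∀ t ∈ D, ‖F t‖ ≤ k) : (fun t => (1 - F t)⁻¹) ∈ uniformClosure V D := by
  refine mem_uniformClosure_of_approx fun ε hε => ?_
  obtain ⟨n, hn⟩ := exists_pow_lt_of_lt_one hε hk1
  refine ⟨∑ i ∈ Finset.range n, F ^ i, Submodule.sum_mem _ fun i _ =>
    pow_mem_uniformClosure h1 hmul hF i, fun t ht => ?_⟩
  have hFt : ‖F t‖ < 1 := (hFk t ht).trans_lt hk1
  have hn1 : ‖1 - F t‖ = 1 := by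
    rw [← norm_one (α := K)]
    refine norm_eq_of_norm_sub_lt ?_
    rw [sub_sub_cancel, norm_one]
    exact hFt
  have hne : 1 - F t ≠ 0 := norm_pos_iff.1 (by rw [hn1]; exact one_pos)
  have h2 := mul_neg_geom_sum (F t) n
  have e : (1 - F t)⁻¹ - (∑ i ∈ Finset.range n, F ^ i) t = (1 - F t)⁻¹ * F t ^ n := by
    have h3 : (∑ i ∈ Finset.range n, F ^ i) t = ∑ i ∈ Finset.range n, F t ^ i := by
      simp [Finset.sum_apply]
    rw [h3]
    have h4 : F t ^ n = 1 - (1 - F t) * ∑ i ∈ Finset.range n, F t ^ i := by rw [h2]; ring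
    rw [h4, mul_sub, mul_one, inv_mul_cancel_left₀ hne]
  rw [e, norm_mul, norm_inv, hn1, inv_one, one_mul, norm_pow]
  exact (pow_le_pow_left₀ (norm_nonneg _) (hFk t ht) n).trans hn.le

theorem hasSum_mem_uniformClosure {u : ℕ → K} (hu : Tendsto u atTop (𝓝 0)) {Q : ℕ → K → K}
    (hQ : ∀ n, Q n ∈ uniformClosure V D) (hQ1 : ∀ n, ∀ t ∈ D, ‖Q n t‖ ≤ 1) {F : K → K}
    (hF : ∀ t ∈ D, HasSum (fun n => u n * Q n t) (F t)) : F ∈ uniformClosure V D := by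
  refine mem_uniformClosure_of_approx fun ε hε => ?_
  obtain ⟨N, hN⟩ := eventually_atTop.1 (by
    have := hu.norm
    rw [norm_zero] at this
    exact this.eventually (gt_mem_nhds hε))
  refine ⟨∑ n ∈ Finset.range N, u n • Q n, Submodule.sum_mem _ fun n _ =>
    Submodule.smul_mem _ _ (hQ n), fun t ht => ?_⟩
  have h := (hasSum_nat_add_iff' N).2 (hF t ht)
  simp only [Finset.sum_apply, Pi.smul_apply, smul_eq_mul]
  exact norm_le_of_hasSum h hε.le fun n =>
    norm_mul_le_of_le_one (hN _ (Nat.le_add_left _ _)).le (hQ1 _ t ht)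

end UniformClosure

/-! ### Holomorphic functions on the unit disc and Krasner analytic functions on the arc -/

/-- The polynomial functions. -/
def polynomialSpan (K : Type*) [NontriviallyNormedField K] : Submodule K (K → K) :=
  Submodule.span K (Set.range fun (n : ℕ) (t : K) => t ^ n)

/-- The rational functions whose poles are simple and lie outside the open disc with centre `1` and
radius `1`, written through their partial fractions. -/
def simplePoleSpan (K : Type*) [NontriviallyNormedField K] : Submodule K (K → K) :=
  Submodule.span K ((Set.range fun (n : ℕ) (t : K) => t ^ n) ∪
    {G | ∃ c : K, 1 ≤ ‖c - 1‖ ∧ G = fun t => (t - c)⁻¹})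

/-- The uniform limits of polynomials on the closed unit disc; these are the functions holomorphic
there. -/
def holomorphicSpace (K : Type*) [NontriviallyNormedField K] [IsUltrametricDist K] :
    Submodule K (K → K) :=
  uniformClosure (polynomialSpan K) (Metric.closedBall 0 1)

/-- The uniform limits, on the open disc with centre `1` and radius `1`, of rational functions with
simple poles outside it; these are the functions Krasner analytic there. -/
def krasnerSpace (K : Type*) [NontriviallyNormedField K] [IsUltrametricDist K] :
    Submodule K (K → K) :=
  uniformClosure (simplePoleSpan K) (Metric.ball 1 1)

theorem norm_le_one_of_mem_ball {t : K} (ht : t ∈ Metric.ball (1 : K) 1) : ‖t‖ ≤ 1 := by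
  rw [← sub_add_cancel t 1]
  exact norm_add_le_of_le (mem_ball_iff_norm.1 ht).le (by simp)

theorem ball_subset_closedBall_zero : Metric.ball (1 : K) 1 ⊆ Metric.closedBall 0 1 :=
  fun _ ht => mem_closedBall_zero_iff.2 (norm_le_one_of_mem_ball ht)

theorem one_le_norm_sub_of_mem_ball {t c : K} (ht : t ∈ Metric.ball (1 : K) 1)
    (hc : 1 ≤ ‖c - 1‖) : 1 ≤ ‖t - c‖ := by
  by_contra! h
  have e : c - 1 = (t - 1) - (t - c) := by ring
  rw [e] at hc
  exact absurd (norm_sub_lt_of_lt (mem_ball_iff_norm.1 ht) h) (not_lt.2 hc)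

theorem norm_inv_sub_le_one {t c : K} (ht : t ∈ Metric.ball (1 : K) 1)
    (hc : 1 ≤ ‖c - 1‖) : ‖(t - c)⁻¹‖ ≤ 1 := by
  rw [norm_inv]
  exact inv_le_one_of_one_le₀ (one_le_norm_sub_of_mem_ball ht hc)

theorem sub_ne_zero_of_mem_ball {t c : K} (ht : t ∈ Metric.ball (1 : K) 1)
    (hc : 1 ≤ ‖c - 1‖) : t - c ≠ 0 :=
  norm_pos_iff.1 (one_pos.trans_le (one_le_norm_sub_of_mem_ball ht hc))

theorem exists_bound_of_mem_span {S : Set (K → K)} {D : Set K}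
    (hS : ∀ G ∈ S, ∀ t ∈ D, ‖G t‖ ≤ 1) {G : K → K} (hG : G ∈ Submodule.span K S) :
    ∃ C : ℝ, ∀ t ∈ D, ‖G t‖ ≤ C := by
  induction hG using Submodule.span_induction with
  | mem G h => exact ⟨1, hS G h⟩
  | zero => exact ⟨0, fun t _ => by simp⟩
  | add F G _ _ h1 h2 =>
    obtain ⟨C, hC⟩ := h1
    obtain ⟨C', hC'⟩ := h2
    exact ⟨max C C', fun t ht => norm_add_le_of_le ((hC t ht).trans (le_max_left _ _))
      ((hC' t ht).trans (le_max_right _ _))⟩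
  | smul c F _ h =>
    obtain ⟨C, hC⟩ := h
    refine ⟨‖c‖ * C, fun t ht => ?_⟩
    rw [Pi.smul_apply, norm_smul]
    exact mul_le_mul_of_nonneg_left (hC t ht) (norm_nonneg _)

omit [IsUltrametricDist K] in
theorem mul_mem_of_mem_span {S : Set (K → K)} {W : Submodule K (K → K)}
    (hS : ∀ F ∈ S, ∀ G ∈ S, F * G ∈ W) : ∀ F ∈ Submodule.span K S, ∀ G ∈ Submodule.span K S,
    F * G ∈ W := by
  intro F hF G hG
  have h := Submodule.mul_mem_mul hF hG
  rw [Submodule.span_mul_span] at h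
  refine Submodule.span_le.2 ?_ h
  rintro _ ⟨F, hF, G, hG, rfl⟩
  exact hS F hF G hG

theorem polynomialSpan_bounded : ∀ G ∈ polynomialSpan K, ∃ C : ℝ,
    ∀ t ∈ Metric.closedBall (0 : K) 1, ‖G t‖ ≤ C := by
  refine fun G hG => exists_bound_of_mem_span ?_ hG
  rintro _ ⟨n, rfl⟩ t ht
  exact norm_pow_le_one (mem_closedBall_zero_iff.1 ht) n

theorem simplePoleSpan_bounded : ∀ G ∈ simplePoleSpan K, ∃ C : ℝ,
    ∀ t ∈ Metric.ball (1 : K) 1, ‖G t‖ ≤ C := by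
  refine fun G hG => exists_bound_of_mem_span ?_ hG
  rintro _ (⟨n, rfl⟩ | ⟨c, hc, rfl⟩) t ht
  · exact norm_pow_le_one (norm_le_one_of_mem_ball ht) n
  · exact norm_inv_sub_le_one ht hc

omit [IsUltrametricDist K] in
theorem polynomialSpan_le_simplePoleSpan : polynomialSpan K ≤ simplePoleSpan K :=
  Submodule.span_mono Set.subset_union_left

theorem holomorphicSpace_le_krasnerSpace : holomorphicSpace K ≤ krasnerSpace K :=
  uniformClosure_mono polynomialSpan_le_simplePoleSpan ball_subset_closedBall_zero

theorem pow_mem_holomorphicSpace (n : ℕ) : (fun t : K => t ^ n) ∈ holomorphicSpace K :=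
  le_uniformClosure (Submodule.subset_span ⟨n, rfl⟩)

theorem one_mem_holomorphicSpace : (1 : K → K) ∈ holomorphicSpace K := by
  convert pow_mem_holomorphicSpace (K := K) 0 using 1
  funext t
  simp

theorem mul_mem_holomorphicSpace : ∀ F ∈ holomorphicSpace K, ∀ G ∈ holomorphicSpace K,
    F * G ∈ holomorphicSpace K := by
  refine fun F hF G hG => mul_mem_uniformClosure polynomialSpan_bounded
    (mul_mem_of_mem_span ?_) hF hG
  rintro _ ⟨m, rfl⟩ _ ⟨n, rfl⟩
  refine mem_uniformClosure_congr (pow_mem_holomorphicSpace (m + n)) fun t _ => ?_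
  exact (pow_add t m n).symm

theorem inv_one_sub_mem_holomorphicSpace {F : K → K} (hF : F ∈ holomorphicSpace K) {k : ℝ}
    (hk1 : k < 1) (hFk : ∀ t ∈ Metric.closedBall (0 : K) 1, ‖F t‖ ≤ k) :
    (fun t => (1 - F t)⁻¹) ∈ holomorphicSpace K :=
  inv_one_sub_mem_uniformClosure one_mem_holomorphicSpace mul_mem_holomorphicSpace hF hk1 hFk

/-- If `H` maps the closed unit disc into itself and `c` lies outside it, then `1 / (H - c)` is given by a
geometric series. -/
theorem inv_sub_mem_holomorphicSpace {H : K → K} (hH : H ∈ holomorphicSpace K)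
    (hH1 : ∀ t ∈ Metric.closedBall (0 : K) 1, ‖H t‖ ≤ 1) {c : K} (hc : 1 < ‖c‖) :
    (fun t => (H t - c)⁻¹) ∈ holomorphicSpace K := by
  have hc0 : c ≠ 0 := norm_pos_iff.1 (one_pos.trans hc)
  have h := Submodule.smul_mem _ (-c⁻¹) (inv_one_sub_mem_holomorphicSpace
    (Submodule.smul_mem _ c⁻¹ hH) (inv_lt_one_of_one_lt₀ hc) fun t ht => by
      rw [Pi.smul_apply, norm_smul, norm_inv]
      exact mul_le_of_le_one_right (by positivity) (hH1 t ht))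
  convert h using 1
  funext t
  simp only [Pi.smul_apply, smul_eq_mul]
  rw [neg_inv, ← mul_inv]
  congr 1
  field_simp
  ring

theorem pow_mem_krasnerSpace (n : ℕ) : (fun t : K => t ^ n) ∈ krasnerSpace K :=
  holomorphicSpace_le_krasnerSpace (pow_mem_holomorphicSpace n)

theorem inv_sub_mem_krasnerSpace {c : K} (hc : 1 ≤ ‖c - 1‖) :
    (fun t => (t - c)⁻¹) ∈ krasnerSpace K :=
  le_uniformClosure (Submodule.subset_span (Or.inr ⟨c, hc, rfl⟩))

theorem pow_mul_inv_sub_mem_krasnerSpace (n : ℕ) {c : K} (hc : 1 ≤ ‖c - 1‖) :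
    (fun t => t ^ n * (t - c)⁻¹) ∈ krasnerSpace K := by
  induction n with
  | zero => simpa using inv_sub_mem_krasnerSpace hc
  | succ n ih =>
    refine mem_uniformClosure_congr
      (Submodule.add_mem _ (pow_mem_krasnerSpace n) (Submodule.smul_mem _ c ih)) fun t ht => ?_
    have := sub_ne_zero_of_mem_ball ht hc
    simp only [Pi.add_apply, Pi.smul_apply, smul_eq_mul]
    field_simp
    ring

/-- Two distinct poles are separated by partial fractions; a double pole is a uniform limit of pairs
of distinct poles. -/
theorem inv_sub_mul_inv_sub_mem_krasnerSpace {c d : K} (hc : 1 ≤ ‖c - 1‖) (hd : 1 ≤ ‖d - 1‖) :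
    (fun t => (t - c)⁻¹ * (t - d)⁻¹) ∈ krasnerSpace K := by
  have key : ∀ c d : K, 1 ≤ ‖c - 1‖ → 1 ≤ ‖d - 1‖ → c ≠ d →
      (fun t => (t - c)⁻¹ * (t - d)⁻¹) ∈ krasnerSpace K := by
    intro c d hc hd hne
    refine mem_uniformClosure_congr (Submodule.smul_mem _ (c - d)⁻¹ (Submodule.sub_mem _
      (inv_sub_mem_krasnerSpace hc) (inv_sub_mem_krasnerSpace hd))) fun t ht => ?_
    have h1 := sub_ne_zero_of_mem_ball ht hc
    have h2 := sub_ne_zero_of_mem_ball ht hd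
    have h3 := sub_ne_zero.2 hne
    simp only [Pi.sub_apply, Pi.smul_apply, smul_eq_mul]
    field_simp
    ring
  rcases ne_or_eq c d with hne | rfl
  · exact key c d hc hd hne
  · refine mem_uniformClosure_of_approx fun ε hε => ?_
    obtain ⟨η, hη0, hη⟩ := NormedField.exists_norm_lt K (lt_min hε one_pos)
    have hc' : 1 ≤ ‖c + η - 1‖ := by
      by_contra! h
      have e : c - 1 = (c + η - 1) - η := by ring
      rw [e] at hc
      exact absurd (norm_sub_lt_of_lt h (hη.trans_le (min_le_right _ _))) (not_lt.2 hc)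
    refine ⟨_, key c (c + η) hc hc' (by simpa using norm_pos_iff.1 hη0), fun t ht => ?_⟩
    have h1 := sub_ne_zero_of_mem_ball ht hc
    have h2 := sub_ne_zero_of_mem_ball ht hc'
    have e : (t - c)⁻¹ * (t - c)⁻¹ - (t - c)⁻¹ * (t - (c + η))⁻¹
        = -η * ((t - c)⁻¹ * (t - c)⁻¹ * (t - (c + η))⁻¹) := by
      field_simp
      ring
    rw [e]
    refine norm_mul_le_of_le_one ?_ (norm_mul_le_of_le_one (norm_mul_le_of_le_one
      (norm_inv_sub_le_one ht hc) (norm_inv_sub_le_one ht hc)) (norm_inv_sub_le_one ht hc'))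
    rw [norm_neg]
    exact hη.le.trans (min_le_left _ _)

theorem mul_mem_krasnerSpace : ∀ F ∈ krasnerSpace K, ∀ G ∈ krasnerSpace K,
    F * G ∈ krasnerSpace K := by
  refine fun F hF G hG => mul_mem_uniformClosure simplePoleSpan_bounded
    (mul_mem_of_mem_span ?_) hF hG
  rintro _ (⟨m, rfl⟩ | ⟨c, hc, rfl⟩) _ (⟨n, rfl⟩ | ⟨d, hd, rfl⟩)
  · exact holomorphicSpace_le_krasnerSpace
      (mul_mem_holomorphicSpace _ (pow_mem_holomorphicSpace m) _ (pow_mem_holomorphicSpace n))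
  · exact pow_mul_inv_sub_mem_krasnerSpace m hd
  · rw [mul_comm]
    exact pow_mul_inv_sub_mem_krasnerSpace n hc
  · exact inv_sub_mul_inv_sub_mem_krasnerSpace hc hd

theorem one_mem_krasnerSpace : (1 : K → K) ∈ krasnerSpace K :=
  holomorphicSpace_le_krasnerSpace one_mem_holomorphicSpace

theorem eval_mem_holomorphicSpace (P : K[X]) : (fun t => P.eval t) ∈ holomorphicSpace K := by
  have e : (fun t => P.eval t)
      = ∑ n ∈ Finset.range (P.natDegree + 1), P.coeff n • fun t : K => t ^ n := by
    funext t
    rw [eval_eq_sum_range, Finset.sum_apply]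
    rfl
  rw [e]
  exact Submodule.sum_mem _ fun n _ => Submodule.smul_mem _ _ (pow_mem_holomorphicSpace n)

/-- Rational functions without poles in the open disc, multiple poles allowed, are uniform limits of
rational functions with simple poles. -/
theorem eval_div_eval_mem_krasnerSpace [IsAlgClosed K] (P Q : K[X])
    (hQ : ∀ t ∈ Metric.ball (1 : K) 1, Q.eval t ≠ 0) :
    (fun t => P.eval t / Q.eval t) ∈ krasnerSpace K := by
  have hroots : ∀ c ∈ Q.roots, 1 ≤ ‖c - 1‖ := by
    intro c hc
    by_contra! h
    exact hQ c (mem_ball_iff_norm.2 h) (isRoot_of_mem_roots hc)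
  have key : ∀ s : Multiset K, (∀ c ∈ s, 1 ≤ ‖c - 1‖) →
      (fun t => (((s.map fun c => X - C c).prod).eval t)⁻¹) ∈ krasnerSpace K := by
    intro s
    induction s using Multiset.induction_on with
    | empty =>
      intro _
      convert one_mem_krasnerSpace (K := K) using 1
      funext t
      simp
    | cons c s ih =>
      intro hs
      have h1 := mul_mem_krasnerSpace _
        (inv_sub_mem_krasnerSpace (hs c (Multiset.mem_cons_self c s))) _
        (ih fun d hd => hs d (Multiset.mem_cons_of_mem hd))
      convert h1 using 1
      funext t
      simp [mul_comm]
  have h2 := Submodule.smul_mem _ Q.leadingCoeff⁻¹ (mul_mem_krasnerSpace _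
    (holomorphicSpace_le_krasnerSpace (eval_mem_holomorphicSpace P)) _ (key _ hroots))
  convert h2 using 1
  funext t
  simp only [Pi.smul_apply, Pi.mul_apply, smul_eq_mul]
  conv_lhs => rw [(IsAlgClosed.splits Q).eq_prod_roots]
  rw [eval_mul, eval_C, div_eq_mul_inv, mul_inv]
  ring

/-! ### Divided differences of power series as holomorphic functions -/

theorem dividedPow_mem_holomorphicSpace (n : ℕ) (s : K) :
    (fun t => dividedPow n t s) ∈ holomorphicSpace K := by
  have e : (fun t => dividedPow n t s)
      = ∑ i ∈ Finset.range n, s ^ (n - 1 - i) • fun t : K => t ^ i := by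
    funext t
    simp [dividedPow, mul_comm]
  rw [e]
  exact Submodule.sum_mem _ fun i _ => Submodule.smul_mem _ _ (pow_mem_holomorphicSpace i)

theorem secondDividedPow_mem_holomorphicSpace (n : ℕ) (s : K) :
    (fun t => secondDividedPow n t s) ∈ holomorphicSpace K := by
  have e : (fun t => secondDividedPow n t s) = ∑ i ∈ Finset.range n,
      (fun t : K => t ^ i) * fun t => dividedPow (n - 1 - i) t s := by
    funext t
    simp [secondDividedPow]
  rw [e]
  exact Submodule.sum_mem _ fun i _ => mul_mem_holomorphicSpace _ (pow_mem_holomorphicSpace i) _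
    (dividedPow_mem_holomorphicSpace _ _)

section Series

variable [CompleteSpace K] {u : ℕ → K} (hu : Tendsto u atTop (𝓝 0))
include hu

theorem seriesDeriv_mem_holomorphicSpace : seriesDeriv u ∈ holomorphicSpace K := by
  refine hasSum_mem_uniformClosure hu (Q := fun n t => n * t ^ (n - 1)) (fun n => ?_)
    (fun n _ ht => norm_mul_le_of_le_one (IsUltrametricDist.norm_natCast_le_one K n)
      (norm_pow_le_one (mem_closedBall_zero_iff.1 ht) _))
    fun _ ht => hasSum_seriesDeriv hu (mem_closedBall_zero_iff.1 ht)
  exact Submodule.smul_mem _ (n : K) (pow_mem_holomorphicSpace (n - 1))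

theorem seriesSlope_mem_holomorphicSpace {s : K} (hs : ‖s‖ ≤ 1) :
    (fun t => seriesSlope u t s) ∈ holomorphicSpace K :=
  hasSum_mem_uniformClosure hu (Q := fun n t => dividedPow n t s)
    (fun n => dividedPow_mem_holomorphicSpace n s)
    (fun n _ ht => norm_dividedPow_le (mem_closedBall_zero_iff.1 ht) hs n)
    fun _ ht => hasSum_seriesSlope hu (mem_closedBall_zero_iff.1 ht) hs

/-- The derivative and the slope at `s` agree at `t = s`, so that their difference is divisible by
`t - s`. -/
theorem exists_seriesDeriv_eq_seriesSlope_add {s : K} (hs : ‖s‖ ≤ 1) :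
    ∃ q ∈ holomorphicSpace K, ∀ t, ‖t‖ ≤ 1 →
      seriesDeriv u t = seriesSlope u t s + q t * (t - s) := by
  have hq : ∀ t, ‖t‖ ≤ 1 → Summable fun n => u n * secondDividedPow n t s := fun t ht =>
    summable_of_tendsto_zero (tendsto_mul_zero_of_norm_le_one hu (norm_secondDividedPow_le ht hs))
  refine ⟨fun t => ∑' n, u n * secondDividedPow n t s,
    hasSum_mem_uniformClosure hu (Q := fun n t => secondDividedPow n t s)
      (fun n => secondDividedPow_mem_holomorphicSpace n s)
      (fun n t ht => norm_secondDividedPow_le (mem_closedBall_zero_iff.1 ht) hs n)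
      fun t ht => (hq t (mem_closedBall_zero_iff.1 ht)).hasSum, fun t ht => ?_⟩
  rw [← sub_eq_iff_eq_add']
  refine ((hasSum_seriesDeriv hu ht).sub (hasSum_seriesSlope hu ht hs)).unique ?_
  refine ((hq t ht).hasSum.mul_right (t - s)).congr_fun fun n => ?_
  rw [mul_assoc, secondDividedPow_mul_sub, mul_sub]

end Series

/-! ### The uniform bound for the arc sums -/

omit [IsUltrametricDist K] in
theorem exists_hasSum_of_mem_simplePoleSpan {G : K → K} (hG : G ∈ simplePoleSpan K) :
    ∃ c : ℕ → K, ∀ t ∈ Metric.ball (1 : K) 1, HasSum (fun n => c n * (t - 1) ^ n) (G t) := by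
  induction hG using Submodule.span_induction with
  | mem G h =>
    rcases h with ⟨n, rfl⟩ | ⟨c, hc, rfl⟩
    · refine ⟨fun m => (n.choose m : K), fun t _ => ?_⟩
      have e : t ^ n = ∑ m ∈ Finset.range (n + 1), (n.choose m : K) * (t - 1) ^ m := by
        conv_lhs => rw [← sub_add_cancel t 1, add_pow]
        exact Finset.sum_congr rfl fun m _ => by ring
      simp only
      rw [e]
      refine hasSum_sum_of_ne_finset_zero fun m hm => ?_
      rw [Nat.choose_eq_zero_of_lt (by simpa using hm), Nat.cast_zero, zero_mul]
    · refine ⟨fun n => -((c - 1) ^ (n + 1))⁻¹, fun t ht => ?_⟩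
      have hc0 : c - 1 ≠ 0 := norm_pos_iff.1 (one_pos.trans_le hc)
      have h1 : ‖(t - 1) / (c - 1)‖ < 1 := by
        rw [norm_div, div_lt_one (one_pos.trans_le hc)]
        exact (mem_ball_iff_norm.1 ht).trans_le hc
      have h2 := (hasSum_geometric_of_norm_lt_one h1).mul_left (-(c - 1)⁻¹)
      have e : -(c - 1)⁻¹ * (1 - (t - 1) / (c - 1))⁻¹ = (t - c)⁻¹ := by
        rw [neg_inv, ← mul_inv]
        congr 1
        field_simp
        ring
      rw [e] at h2
      refine h2.congr_fun fun n => ?_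
      rw [div_pow]
      field_simp
      ring
  | zero => exact ⟨0, fun t _ => by simp⟩
  | add F G _ _ h1 h2 =>
    obtain ⟨c, hc⟩ := h1
    obtain ⟨d, hd⟩ := h2
    refine ⟨c + d, fun t ht => ((hc t ht).add (hd t ht)).congr_fun fun n => ?_⟩
    simp [add_mul]
  | smul a F _ h =>
    obtain ⟨c, hc⟩ := h
    refine ⟨a • c, fun t ht => ((hc t ht).mul_left a).congr_fun fun n => ?_⟩
    simp [mul_assoc]

/-- The bound of `norm_rootMean_le_of_hasSum` extends to Krasner analytic functions: for fixed `N` the arc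
sum is continuous in the uniform norm, by the trivial bound. -/
theorem norm_rootMean_le [IsAlgClosed K] [CharZero K] {p : ℕ} (hp : p.Prime)
    (hpK : ‖(p : K)‖ < 1) (N : ℕ) {F : K → K} (hF : F ∈ krasnerSpace K) {C : ℝ} (hC : 0 ≤ C)
    (hb : ∀ t ∈ Metric.ball (1 : K) 1, ‖F t‖ ≤ C) : ‖rootMean p N F‖ ≤ C := by
  refine le_of_forall_pos_le_add fun ε hε => ?_
  set q := ‖((p : K) ^ N)⁻¹‖ with hq
  have hq0 : 0 < q := norm_pos_iff.2 (inv_ne_zero (natCast_pow_ne_zero hp N))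
  obtain ⟨G, hG, h1⟩ := hF (min ε (ε / q)) (by positivity)
  obtain ⟨c, hc⟩ := exists_hasSum_of_mem_simplePoleSpan hG
  have h2 : ‖rootMean p N G‖ ≤ C + ε := by
    refine norm_rootMean_le_of_hasSum hp hpK N (by positivity) hc fun t ht => ?_
    rw [← sub_sub_cancel (F t) (G t)]
    exact norm_sub_le_of_le ((hb t ht).trans (by linarith))
      ((h1 t ht).trans ((min_le_left _ _).trans (by linarith)))
  have h3 : ‖rootMean p N (F - G)‖ ≤ C + ε := by
    refine (norm_rootMean_le_mul hp hpK N (by positivity) h1).trans ?_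
    calc q * min ε (ε / q) ≤ q * (ε / q) := mul_le_mul_of_nonneg_left (min_le_right _ _) hq0.le
      _ = ε := mul_div_cancel₀ _ hq0.ne'
      _ ≤ C + ε := by linarith
  rw [rootMean_sub] at h3
  rw [← sub_add_cancel (rootMean p N F) (rootMean p N G)]
  exact norm_add_le_of_le h3 h2

section ArcSums

variable [CompleteSpace K] [IsAlgClosed K] [CharZero K] {p : ℕ} (hp : p.Prime) (hpK : ‖(p : K)‖ < 1)

/-! ### Convergence of the arc sums -/

section Convergence

theorem tendsto_progression (α : ℕ) {l : ℕ} (hl : 1 ≤ l) :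
    Tendsto (fun k : ℕ => α + l * k) atTop atTop :=
  tendsto_atTop_mono (fun k => show k ≤ α + l * k by nlinarith) tendsto_id

include hp hpK

omit [CompleteSpace K] in
/-- The arc sums of a polynomial vanish from some `N` on. -/
theorem tendsto_rootMean_holomorphic {F : K → K} (hF : F ∈ holomorphicSpace K) :
    Tendsto (fun N => rootMean p N F) atTop (𝓝 0) := by
  have hpoly : ∀ G ∈ polynomialSpan K, Tendsto (fun N => rootMean p N G) atTop (𝓝 0) := by
    intro G hG
    induction hG using Submodule.span_induction with
    | mem G h =>
      obtain ⟨n, rfl⟩ := h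
      refine tendsto_const_nhds.congr' ?_
      filter_upwards [eventually_ge_atTop (n + 1)] with N hN
      rw [rootMean_pow hp, if_neg]
      intro hd
      have h1 := Nat.le_of_dvd (Nat.succ_pos n) hd
      have h2 := Nat.lt_pow_self hp.one_lt (n := N)
      omega
    | zero => simp [rootMean]
    | add F G _ _ h1 h2 => simpa [rootMean_add] using h1.add h2
    | smul c F _ h => simpa [rootMean_smul] using h.const_mul c
  rw [Metric.tendsto_atTop]
  intro ε hε
  obtain ⟨G, hG, h1⟩ := hF (ε / 2) (by positivity)
  obtain ⟨N₀, hN₀⟩ := (Metric.tendsto_atTop.1 (hpoly G hG)) ε hε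
  refine ⟨N₀, fun N hN => ?_⟩
  have h2 := hN₀ N hN
  rw [dist_zero_right] at h2 ⊢
  have h3 : ‖rootMean p N (F - G)‖ ≤ ε / 2 := norm_rootMean_le hp hpK N
    (holomorphicSpace_le_krasnerSpace (Submodule.sub_mem _ hF (le_uniformClosure hG)))
    (by positivity) fun t ht => h1 t (ball_subset_closedBall_zero ht)
  rw [rootMean_sub] at h3
  rw [← sub_add_cancel (rootMean p N F) (rootMean p N G)]
  exact norm_add_lt_of_lt (h3.trans_lt (by linarith)) h2

omit [CompleteSpace K] [IsAlgClosed K] [CharZero K] in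
theorem one_le_norm_one_sub_pow {c : K} (hc1 : ‖c‖ ≤ 1) (hc : 1 ≤ ‖c - 1‖) (N : ℕ) :
    1 ≤ ‖1 - c ^ p ^ N‖ := by
  by_contra! h
  rw [norm_sub_rev] at h
  have h1 := (norm_pow_sub_pow_lt_one_iff hp hpK hc1 (y := 1) (by simp) N).1 (by rwa [one_pow])
  exact absurd h1 (not_lt.2 hc)

omit [CompleteSpace K] in
theorem rootMean_inv_sub_of_norm_le_one {c : K} (hc1 : ‖c‖ ≤ 1) (hc : 1 ≤ ‖c - 1‖) (N : ℕ) :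
    rootMean p N (fun t : K => (t - c)⁻¹) = (1 - c ^ p ^ N)⁻¹ := by
  refine rootMean_inv_sub hp N fun h => ?_
  have := one_le_norm_one_sub_pow hp hpK hc1 hc N
  rw [h, sub_self, norm_zero] at this
  exact absurd this (by norm_num)

/-- If `‖c‖ ≤ 1` and `c ^ p ^ l` has the same residue as `c`, then `c ^ p ^ N` converges when `N` runs through
`α + l k`, and so does the arc sum `1 / (1 - c ^ p ^ N)`. If `‖c‖ > 1`, the arc sums tend to `0`. -/
theorem exists_tendsto_rootMean_inv_sub (α : ℕ)
    (hres : ∀ c : K, ‖c‖ ≤ 1 → ∃ l : ℕ, 1 ≤ l ∧ ‖c ^ p ^ l - c‖ < 1) {c : K} (hc : 1 ≤ ‖c - 1‖) :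
    ∃ l : ℕ, 1 ≤ l ∧ ∃ L : K,
      Tendsto (fun k => rootMean p (α + l * k) (fun t : K => (t - c)⁻¹)) atTop (𝓝 L) := by
  rcases le_or_gt ‖c‖ 1 with hc1 | hc1
  · obtain ⟨l, hl, hlc⟩ := hres c hc1
    have h1 : Tendsto (fun k : ℕ => c ^ p ^ (α + l * (k + 1)) - c ^ p ^ (α + l * k))
        atTop (𝓝 0) := by
      refine ((tendsto_pow_sub_pow hp hpK (norm_pow_le_one hc1 _) hc1 hlc).comp
        (tendsto_progression α hl)).congr
        fun k => ?_
      simp only [Function.comp]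
      rw [← pow_mul, ← pow_add]
      congr 3
      ring
    have hC : CauchySeq fun k : ℕ => c ^ p ^ (α + l * k) :=
      NonarchimedeanAddGroup.cauchySeq_of_tendsto_sub_nhds_zero h1
    obtain ⟨Y, hY⟩ := cauchySeq_tendsto_of_complete hC
    have hY' : Tendsto (fun k : ℕ => 1 - c ^ p ^ (α + l * k)) atTop (𝓝 (1 - Y)) :=
      tendsto_const_nhds.sub hY
    have hY1 : 1 ≤ ‖1 - Y‖ := ge_of_tendsto' hY'.norm fun k =>
      one_le_norm_one_sub_pow hp hpK hc1 hc (α + l * k)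
    refine ⟨l, hl, (1 - Y)⁻¹, ?_⟩
    refine Tendsto.congr (fun k => (rootMean_inv_sub_of_norm_le_one hp hpK hc1 hc _).symm) ?_
    exact hY'.inv₀ (norm_pos_iff.1 (one_pos.trans_le hY1))
  · refine ⟨1, le_rfl, 0, ?_⟩
    have h := inv_sub_mem_holomorphicSpace (H := fun t : K => t)
      (by simpa using pow_mem_holomorphicSpace (K := K) 1)
      (fun t ht => mem_closedBall_zero_iff.1 ht) hc1
    refine (tendsto_rootMean_holomorphic hp hpK h).comp (tendsto_progression α le_rfl)

theorem exists_tendsto_rootMean_of_mem_simplePoleSpan (α : ℕ)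
    (hres : ∀ c : K, ‖c‖ ≤ 1 → ∃ l : ℕ, 1 ≤ l ∧ ‖c ^ p ^ l - c‖ < 1) {G : K → K}
    (hG : G ∈ simplePoleSpan K) : ∃ l : ℕ, 1 ≤ l ∧ ∃ L : K,
      Tendsto (fun k => rootMean p (α + l * k) G) atTop (𝓝 L) := by
  induction hG using Submodule.span_induction with
  | mem G h =>
    rcases h with ⟨n, rfl⟩ | ⟨c, hc, rfl⟩
    · refine ⟨1, le_rfl, 0, ?_⟩
      refine (tendsto_rootMean_holomorphic hp hpK (pow_mem_holomorphicSpace n)).comp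
        (tendsto_progression α le_rfl)
    · exact exists_tendsto_rootMean_inv_sub hp hpK α hres hc
  | zero => exact ⟨1, le_rfl, 0, by simp [rootMean]⟩
  | add F G _ _ h1 h2 =>
    obtain ⟨l, hl, L, hL⟩ := h1
    obtain ⟨l', hl', L', hL'⟩ := h2
    refine ⟨l * l', Nat.mul_pos hl hl', L + L', ?_⟩
    have t1 : Tendsto (fun k : ℕ => l' * k) atTop atTop := by
      simpa using tendsto_progression 0 hl'
    have t2 : Tendsto (fun k : ℕ => l * k) atTop atTop := by
      simpa using tendsto_progression 0 hl
    refine ((hL.comp t1).add (hL'.comp t2)).congr fun k => ?_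
    simp only [Function.comp]
    rw [rootMean_add, ← mul_assoc, ← mul_assoc, mul_comm l' l]
  | smul c F _ h =>
    obtain ⟨l, hl, L, hL⟩ := h
    exact ⟨l, hl, c * L, by simpa [rootMean_smul] using hL.const_mul c⟩

/-- The arc integral of a Krasner analytic function exists. Its value is the limit over the exponents
`α + j!`, which eventually run inside every progression `α + l k`. -/
theorem exists_rootMean_limit (α : ℕ)
    (hres : ∀ c : K, ‖c‖ ≤ 1 → ∃ l : ℕ, 1 ≤ l ∧ ‖c ^ p ^ l - c‖ < 1) {F : K → K}
    (hF : F ∈ krasnerSpace K) : ∃ L : K, ∀ ε : ℝ, 0 < ε → ∃ l : ℕ, 1 ≤ l ∧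
      ∀ᶠ k in atTop, ‖rootMean p (α + l * k) F - L‖ < ε := by
  have approx : ∀ ε : ℝ, 0 < ε → ∃ G : K → K, (∀ N, ‖rootMean p N F - rootMean p N G‖ ≤ ε) ∧
      ∃ l : ℕ, 1 ≤ l ∧ ∃ L : K, Tendsto (fun k => rootMean p (α + l * k) G) atTop (𝓝 L) ∧
        Tendsto (fun j : ℕ => rootMean p (α + j.factorial) G) atTop (𝓝 L) := by
    intro ε hε
    obtain ⟨G, hG, h1⟩ := hF ε hε
    obtain ⟨l, hl, L, hL⟩ := exists_tendsto_rootMean_of_mem_simplePoleSpan hp hpK α hres hG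
    refine ⟨G, fun N => ?_, l, hl, L, hL, ?_⟩
    · rw [← rootMean_sub]
      exact norm_rootMean_le hp hpK N (Submodule.sub_mem _ hF (le_uniformClosure hG)) hε.le h1
    · have t1 : Tendsto (fun j : ℕ => j.factorial / l) atTop atTop := by
        refine tendsto_atTop_atTop.2 fun b => ⟨l * b + 1, fun j hj => ?_⟩
        rw [Nat.le_div_iff_mul_le hl, mul_comm]
        have := Nat.self_le_factorial j
        omega
      refine (hL.comp t1).congr' ?_
      filter_upwards [eventually_ge_atTop l] with j hj
      simp only [Function.comp]
      rw [Nat.mul_div_cancel' (Nat.dvd_factorial hl hj)]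
  have hC : CauchySeq (fun j : ℕ => rootMean p (α + j.factorial) F) := by
    rw [Metric.cauchySeq_iff]
    intro ε hε
    obtain ⟨G, h1, _, _, _, _, h2⟩ := approx (ε / 2) (by positivity)
    obtain ⟨N, hN⟩ := (Metric.cauchySeq_iff.1 h2.cauchySeq) ε hε
    refine ⟨N, fun m hm n hn => ?_⟩
    have h3 := hN m hm n hn
    have hm1 := h1 (α + m.factorial)
    have hn1 := h1 (α + n.factorial)
    rw [dist_eq_norm] at h3 ⊢
    have e : ∀ a b a' b' : K, a - b = (a - a') + ((a' - b') - (b - b')) := fun a b a' b' => by ring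
    rw [e _ _ (rootMean p (α + m.factorial) G) (rootMean p (α + n.factorial) G)]
    exact norm_add_lt_of_lt (hm1.trans_lt (by linarith))
      (norm_sub_lt_of_lt h3 (hn1.trans_lt (by linarith)))
  obtain ⟨L, hL⟩ := cauchySeq_tendsto_of_complete hC
  refine ⟨L, fun ε hε => ?_⟩
  obtain ⟨G, h1, l, hl, L', h2, h3⟩ := approx (ε / 2) (by positivity)
  have h4 : ‖L - L'‖ ≤ ε / 2 := le_of_tendsto' (hL.sub h3).norm fun j => h1 _
  refine ⟨l, hl, ?_⟩
  filter_upwards [Metric.tendsto_nhds.1 h2 ε hε] with k hk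
  rw [dist_eq_norm] at hk
  have e : rootMean p (α + l * k) F - L = (rootMean p (α + l * k) F - rootMean p (α + l * k) G)
      + ((rootMean p (α + l * k) G - L') - (L - L')) := by ring
  rw [e]
  exact norm_add_lt_of_lt ((h1 _).trans_lt (by linarith))
    (norm_sub_lt_of_lt hk (h4.trans_lt (by linarith)))

end Convergence

/-! ### Substitution -/

section Substitution

/-- The function `G (F t) F' t`, where `F` is the sum of the power series with coefficients `u`. -/
noncomputable def pullback (u : ℕ → K) (F G : K → K) (t : K) : K :=
  G (F t) * seriesDeriv u t

variable {u : ℕ → K} (hu : Tendsto u atTop (𝓝 0))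
include hu

variable {F : K → K} (hF : ∀ t, ‖t‖ ≤ 1 → HasSum (fun n => u n * t ^ n) (F t))
  (h0 : u 0 = 0) (hu1 : ‖u 1‖ = 1) (hu2 : ∀ n, 2 ≤ n → ‖u n‖ < 1) (hF1 : F 1 = 1)
include hF h0 hu1 hu2 hF1

include hp hpK

/-- The pullback of a generator of `simplePoleSpan` is Krasner analytic and has asymptotically the
same arc sums. For `1 / (t - c)` with a pole `c = F s` in the closed unit disc, the factorization of
`F t - F s` into `t - s` and a function `w` without zeros shows that the pullback differs from
`1 / (t - s)` by a function holomorphic on the whole disc; moreover `c` and `s` are in the same residue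
disc. -/
theorem pullback_mem_and_tendsto {G : K → K} (hG : G ∈ simplePoleSpan K) :
    pullback u F G ∈ krasnerSpace K ∧
      Tendsto (fun N => rootMean p N (pullback u F G) - rootMean p N G) atTop (𝓝 0) := by
  have hu1' := norm_coeff_le_one_of_lt h0 hu1 hu2
  obtain ⟨k, hk0, hk1, hk⟩ := exists_norm_seriesSlope_sub_one_le hu hF h0 hu2 hF1
  have hslope : ∀ t s, ‖t‖ ≤ 1 → ‖s‖ ≤ 1 → ‖seriesSlope u t s‖ ≤ 1 := fun t s ht hs =>
    norm_le_of_hasSum (hasSum_seriesSlope hu ht hs) zero_le_one fun n =>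
      norm_mul_le_of_le_one (hu1' n) (norm_dividedPow_le ht hs n)
  have hFh : F ∈ holomorphicSpace K := hasSum_mem_uniformClosure hu (Q := fun n t => t ^ n)
    (fun n => pow_mem_holomorphicSpace n)
    (fun n t ht => norm_pow_le_one (mem_closedBall_zero_iff.1 ht) n)
    fun t ht => hF t (mem_closedBall_zero_iff.1 ht)
  have hFle : ∀ t ∈ Metric.closedBall (0 : K) 1, ‖F t‖ ≤ 1 := fun t ht =>
    norm_le_of_hasSum (hF t (mem_closedBall_zero_iff.1 ht)) zero_le_one fun n =>
      norm_mul_le_of_le_one (hu1' n) (norm_pow_le_one (mem_closedBall_zero_iff.1 ht) n)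
  have hdh := seriesDeriv_mem_holomorphicSpace hu
  have hholo : ∀ G : K → K, G ∈ holomorphicSpace K → pullback u F G ∈ holomorphicSpace K →
      pullback u F G ∈ krasnerSpace K ∧
        Tendsto (fun N => rootMean p N (pullback u F G) - rootMean p N G) atTop (𝓝 0) := by
    intro G hG hG'
    refine ⟨holomorphicSpace_le_krasnerSpace hG', ?_⟩
    simpa using (tendsto_rootMean_holomorphic hp hpK hG').sub
      (tendsto_rootMean_holomorphic hp hpK hG)
  induction hG using Submodule.span_induction with
  | mem G h =>
    rcases h with ⟨n, rfl⟩ | ⟨c, hc, rfl⟩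
    · refine hholo _ (pow_mem_holomorphicSpace n) ?_
      exact mul_mem_holomorphicSpace _ (pow_mem_uniformClosure one_mem_holomorphicSpace
        mul_mem_holomorphicSpace hFh n) _ hdh
    · rcases lt_or_ge 1 ‖c‖ with hc1 | hc1
      · refine hholo _ (inv_sub_mem_holomorphicSpace (H := fun t : K => t)
          (by simpa using pow_mem_holomorphicSpace (K := K) 1)
          (fun t ht => mem_closedBall_zero_iff.1 ht) hc1) ?_
        exact mul_mem_holomorphicSpace _ (inv_sub_mem_holomorphicSpace hFh hFle hc1) _ hdh
      · obtain ⟨s, hs, hsc⟩ := (bijOn_of_coeff hu hF h0 hu1 hu2).surjOn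
          (mem_closedBall_zero_iff.2 hc1)
        rw [mem_closedBall_zero_iff] at hs
        have hs1 : 1 ≤ ‖s - 1‖ := by
          have e := seriesSlope_mul_sub hu hF hs (s := 1) (by simp)
          rw [hsc, hF1, mul_comm] at e
          rw [← e] at hc
          exact hc.trans (norm_mul_le_of_le_one le_rfl (hslope s 1 hs (by simp)))
        have hcs : ‖c - s‖ < 1 := by
          have e := seriesSlope_mul_sub hu hF hs (s := 0) (by simp)
          rw [hsc, apply_zero_of_hasSum hF, h0, sub_zero, sub_zero] at e
          have e2 : c - s = (seriesSlope u s 0 - 1) * s := by rw [← e]; ring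
          rw [e2]
          exact (norm_mul_le_of_le_one (hk s 0 hs (by simp)) hs).trans_lt hk1
        obtain ⟨q, hq, hdq⟩ := exists_seriesDeriv_eq_seriesSlope_add hu hs
        have hwinv : (fun t => (seriesSlope u t s)⁻¹) ∈ holomorphicSpace K := by
          have := inv_one_sub_mem_holomorphicSpace
            (Submodule.sub_mem _ one_mem_holomorphicSpace (seriesSlope_mem_holomorphicSpace hu hs))
            hk1 fun t ht => by
              rw [Pi.sub_apply, Pi.one_apply, norm_sub_rev]
              exact hk t s (mem_closedBall_zero_iff.1 ht) hs
          simpa using this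
        have hqw := mul_mem_holomorphicSpace _ hq _ hwinv
        have e : ∀ t ∈ Metric.ball (1 : K) 1, pullback u F (fun t => (t - c)⁻¹) t
            = ((fun t => (t - s)⁻¹) + q * fun t => (seriesSlope u t s)⁻¹) t := by
          intro t ht
          have ht1 := norm_le_one_of_mem_ball ht
          have h1 := sub_ne_zero_of_mem_ball ht hs1
          have h2 : seriesSlope u t s ≠ 0 := by
            intro h
            have := hk t s ht1 hs
            rw [h, zero_sub, norm_neg, norm_one] at this
            linarith
          simp only [pullback, Pi.add_apply, Pi.mul_apply]
          rw [hdq t ht1, ← hsc, ← seriesSlope_mul_sub hu hF ht1 hs]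
          field_simp
        refine ⟨mem_uniformClosure_congr (Submodule.add_mem _ (inv_sub_mem_krasnerSpace hs1)
          (holomorphicSpace_le_krasnerSpace hqw)) e, ?_⟩
        simp_rw [rootMean_congr hp hpK _ e, rootMean_add,
          rootMean_inv_sub_of_norm_le_one hp hpK hc1 hc,
          rootMean_inv_sub_of_norm_le_one hp hpK hs hs1]
        have h3 : Tendsto (fun N : ℕ => (1 - s ^ p ^ N)⁻¹ - (1 - c ^ p ^ N)⁻¹) atTop (𝓝 0) := by
          refine squeeze_zero_norm (fun N => ?_)
            (by simpa using (tendsto_pow_sub_pow hp hpK hc1 hs hcs).norm)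
          have g1 := one_le_norm_one_sub_pow hp hpK hc1 hc N
          have g2 := one_le_norm_one_sub_pow hp hpK hs hs1 N
          have g1' : 1 - c ^ p ^ N ≠ 0 := norm_pos_iff.1 (one_pos.trans_le g1)
          have g2' : 1 - s ^ p ^ N ≠ 0 := norm_pos_iff.1 (one_pos.trans_le g2)
          have e2 : (1 - s ^ p ^ N)⁻¹ - (1 - c ^ p ^ N)⁻¹
              = -(c ^ p ^ N - s ^ p ^ N) * (1 - s ^ p ^ N)⁻¹ * (1 - c ^ p ^ N)⁻¹ := by
            rw [inv_sub_inv g2' g1']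
            field_simp
            ring
          rw [e2, ← norm_neg (c ^ p ^ N - s ^ p ^ N)]
          refine norm_mul_le_of_le_one (norm_mul_le_of_le_one le_rfl ?_) ?_ <;>
          · rw [norm_inv]
            exact inv_le_one_of_one_le₀ (by assumption)
        have h4 := h3.add (tendsto_rootMean_holomorphic hp hpK hqw)
        rw [add_zero] at h4
        refine h4.congr fun N => ?_
        ring
  | zero =>
    have e : pullback u F 0 = 0 := by funext t; simp [pullback]
    rw [e]
    exact ⟨Submodule.zero_mem _, by simp⟩
  | add G H _ _ hG hH =>
    have e : pullback u F (G + H) = pullback u F G + pullback u F H := by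
      funext t
      simp [pullback, add_mul]
    rw [e]
    refine ⟨Submodule.add_mem _ hG.1 hH.1, ?_⟩
    have := hG.2.add hH.2
    rw [add_zero] at this
    refine this.congr fun N => ?_
    rw [rootMean_add, rootMean_add]
    ring
  | smul a G _ hG =>
    have e : pullback u F (a • G) = a • pullback u F G := by
      funext t
      simp [pullback, mul_assoc]
    rw [e]
    refine ⟨Submodule.smul_mem _ _ hG.1, ?_⟩
    have := hG.2.const_mul a
    rw [mul_zero] at this
    refine this.congr fun N => ?_
    rw [rootMean_smul, rootMean_smul]
    ring

/-- The arc sums of a Krasner analytic function and of its pullback agree asymptotically. -/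
theorem tendsto_rootMean_pullback_sub {G : K → K} (hG : G ∈ krasnerSpace K) :
    Tendsto (fun N => rootMean p N (pullback u F G) - rootMean p N G) atTop (𝓝 0) := by
  have hu1' := norm_coeff_le_one_of_lt h0 hu1 hu2
  have hmaps : ∀ t ∈ Metric.ball (1 : K) 1, F t ∈ Metric.ball (1 : K) 1 := by
    intro t ht
    have ht1 := norm_le_one_of_mem_ball ht
    have e := seriesSlope_mul_sub hu hF ht1 (s := 1) (by simp)
    rw [hF1] at e
    rw [mem_ball_iff_norm] at ht ⊢
    rw [← e, mul_comm]
    refine (norm_mul_le_of_le_one le_rfl ?_).trans_lt ht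
    exact norm_le_of_hasSum (hasSum_seriesSlope hu ht1 (by simp)) zero_le_one fun n =>
      norm_mul_le_of_le_one (hu1' n) (norm_dividedPow_le ht1 (by simp) n)
  have hderiv : ∀ t ∈ Metric.ball (1 : K) 1, ‖seriesDeriv u t‖ ≤ 1 := fun t ht =>
    norm_le_of_hasSum (hasSum_seriesDeriv hu (norm_le_one_of_mem_ball ht)) zero_le_one fun n =>
      norm_mul_le_of_le_one (hu1' n) (norm_mul_le_of_le_one
        (IsUltrametricDist.norm_natCast_le_one K n)
        (norm_pow_le_one (norm_le_one_of_mem_ball ht) _))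
  have hpull : ∀ (H : K → K) (ε : ℝ), (∀ t ∈ Metric.ball (1 : K) 1, ‖G t - H t‖ ≤ ε) →
      ∀ t ∈ Metric.ball (1 : K) 1, ‖pullback u F G t - pullback u F H t‖ ≤ ε := by
    intro H ε h t ht
    rw [pullback, pullback, ← sub_mul]
    exact norm_mul_le_of_le_one (h _ (hmaps t ht)) (hderiv t ht)
  have hmem : pullback u F G ∈ krasnerSpace K := mem_uniformClosure_of_approx fun ε hε => by
    obtain ⟨H, hH, h1⟩ := hG ε hε
    exact ⟨pullback u F H, (pullback_mem_and_tendsto hp hpK hu hF h0 hu1 hu2 hF1 hH).1,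
      hpull H ε h1⟩
  rw [Metric.tendsto_atTop]
  intro ε hε
  obtain ⟨H, hH, h1⟩ := hG (ε / 2) (by positivity)
  obtain ⟨hHm, hHt⟩ := pullback_mem_and_tendsto hp hpK hu hF h0 hu1 hu2 hF1 hH
  obtain ⟨N₀, hN₀⟩ := (Metric.tendsto_atTop.1 hHt) ε hε
  refine ⟨N₀, fun N hN => ?_⟩
  have h2 := hN₀ N hN
  rw [dist_zero_right] at h2 ⊢
  have h3 := norm_rootMean_le hp hpK N (Submodule.sub_mem _ hmem hHm)
    (by positivity : 0 ≤ ε / 2) (hpull H _ h1)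
  have h4 := norm_rootMean_le hp hpK N (Submodule.sub_mem _ hG (le_uniformClosure hH))
    (by positivity : 0 ≤ ε / 2) h1
  rw [rootMean_sub] at h3 h4
  have e : rootMean p N (pullback u F G) - rootMean p N G
      = (rootMean p N (pullback u F G) - rootMean p N (pullback u F H))
        + ((rootMean p N (pullback u F H) - rootMean p N H)
          - (rootMean p N G - rootMean p N H)) := by ring
  rw [e]
  exact norm_add_lt_of_lt (h3.trans_lt (by linarith))
    (norm_sub_lt_of_lt h2 (h4.trans_lt (by linarith)))

end Substitution

end ArcSums

/-! ### The field of `p`-adic complex numbers -/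

section PadicComplex

variable (p : ℕ) [hp : Fact p.Prime]

theorem norm_natCast_p_lt_one : ‖(p : ℂ_[p])‖ < 1 := by
  have h : ‖((p : ℚ_[p]) : ℂ_[p])‖ = ‖(p : ℚ_[p])‖ := PadicComplex.norm_extends' p (p : ℚ_[p])
  have e : (((p : ℚ_[p]) : PadicAlgCl p) : ℂ_[p]) = (p : ℂ_[p]) := by
    rw [map_natCast, PadicComplex.coe_natCast]
  rw [e] at h
  rw [h]
  exact Padic.norm_p_lt_one

/-- The residue field of `ℂ_[p]` is algebraic over its prime field. An element of the algebraic
closure of `ℚ_[p]` lies in a finite extension, which is locally compact, so two of its iterated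
`p`-th powers are congruent. -/
theorem exists_norm_pow_sub_lt_one (c : ℂ_[p]) (hc : ‖c‖ ≤ 1) :
    ∃ l : ℕ, 1 ≤ l ∧ ‖c ^ p ^ l - c‖ < 1 := by
  have hpK := norm_natCast_p_lt_one p
  obtain ⟨d, hd⟩ : ∃ d : PadicAlgCl p, ‖c - (d : ℂ_[p])‖ < 1 := by
    obtain ⟨d, hd⟩ := UniformSpace.Completion.denseRange_coe.exists_dist_lt c one_pos
    exact ⟨d, by rwa [dist_eq_norm] at hd⟩
  have hd1 : ‖(d : ℂ_[p])‖ ≤ 1 := by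
    rw [← sub_sub_cancel c (d : ℂ_[p])]
    exact norm_sub_le_of_le hc hd.le
  have hd1' : ‖d‖ ≤ 1 := by rwa [PadicComplex.norm_extends] at hd1
  obtain ⟨i, l, hl, h⟩ : ∃ i l : ℕ, 1 ≤ l ∧ ‖d ^ p ^ (i + l) - d ^ p ^ i‖ < 1 := by
    set E := Subalgebra.toSubmodule (IntermediateField.adjoin ℚ_[p] {d}).toSubalgebra
    have hfin : FiniteDimensional ℚ_[p] E := IntermediateField.adjoin.finiteDimensional
      (Algebra.IsIntegral.isIntegral d)
    have hprop : ProperSpace E := FiniteDimensional.proper ℚ_[p] E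
    have hmem : ∀ i : ℕ, d ^ p ^ i ∈ E := fun i =>
      pow_mem (IntermediateField.mem_adjoin_simple_self ℚ_[p] d) _
    have hball : ∀ i : ℕ, (⟨d ^ p ^ i, hmem i⟩ : E) ∈ Metric.closedBall (0 : E) 1 := fun i => by
      rw [mem_closedBall_zero_iff]
      exact norm_pow_le_one hd1' _
    obtain ⟨a, -, φ, hφ, hlim⟩ := (isCompact_closedBall (0 : E) 1).tendsto_subseq hball
    obtain ⟨N, hN⟩ := Metric.cauchySeq_iff.1 hlim.cauchySeq 1 one_pos
    have h1 := hN (N + 1) (by omega) N le_rfl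
    have h2 : φ N < φ (N + 1) := hφ (Nat.lt_succ_self N)
    refine ⟨φ N, φ (N + 1) - φ N, by omega, ?_⟩
    rw [Nat.add_sub_cancel' h2.le]
    rw [dist_eq_norm] at h1
    exact h1
  have h' : ‖(d : ℂ_[p]) ^ p ^ l - d‖ < 1 := by
    refine (norm_pow_sub_pow_lt_one_iff hp.out hpK (norm_pow_le_one hd1 _) hd1 i).1 ?_
    rw [← pow_mul, ← pow_add, add_comm l i]
    have e : (d : ℂ_[p]) ^ p ^ (i + l) - (d : ℂ_[p]) ^ p ^ i
        = ((d ^ p ^ (i + l) - d ^ p ^ i : PadicAlgCl p) : ℂ_[p]) := by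
      simp only [PadicComplex.coe_eq, map_sub, map_pow]
    rw [e, PadicComplex.norm_extends]
    exact h
  refine ⟨l, hl, ?_⟩
  have e : c ^ p ^ l - c
      = (c ^ p ^ l - (d : ℂ_[p]) ^ p ^ l) + (((d : ℂ_[p]) ^ p ^ l - d) - (c - d)) := by ring
  rw [e]
  exact norm_add_lt_of_lt ((norm_pow_sub_pow_lt_one_iff hp.out hpK hc hd1 l).2 hd)
    (norm_sub_lt_of_lt h' hd)

theorem arcSum_eq_rootMean (a b : ℂ_[p]) (f : ℂ_[p] → ℂ_[p]) (N : ℕ) :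
    arcSum p a b f N = rootMean p N (fun τ => (b - a) * f (a + (b - a) * τ)) := by
  rw [arcSum, rootMean]
  congr 1
  refine Finset.sum_congr rfl fun ζ _ => ?_
  ring

theorem mem_arc_of_mem_ball {a b τ : ℂ_[p]} (hab : a ≠ b) (hτ : τ ∈ Metric.ball (1 : ℂ_[p]) 1) :
    a + (b - a) * τ ∈ arc p a b := by
  rw [arc, mem_ball_iff_norm]
  rw [mem_ball_iff_norm] at hτ
  have e : a + (b - a) * τ - b = -(a - b) * (τ - 1) := by ring
  have h : 0 < ‖a - b‖ := norm_pos_iff.2 (sub_ne_zero.2 hab)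
  rw [e, norm_mul, norm_neg]
  exact mul_lt_of_lt_one_right h hτ

theorem mem_krasnerSpace_of_isKrasnerAnalyticOn {a b : ℂ_[p]} (hab : a ≠ b)
    {f : ℂ_[p] → ℂ_[p]} (hf : IsKrasnerAnalyticOn p f (arc p a b)) :
    (fun τ => (b - a) * f (a + (b - a) * τ)) ∈ krasnerSpace ℂ_[p] := by
  refine Submodule.smul_mem _ (b - a) (x := fun τ => f (a + (b - a) * τ)) ?_
  refine mem_uniformClosure_of_approx fun ε hε => ?_
  obtain ⟨P, Q, hQ, hPQ⟩ := hf ε hε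
  refine ⟨_, eval_div_eval_mem_krasnerSpace (P.comp (C a + C (b - a) * X))
    (Q.comp (C a + C (b - a) * X)) (fun τ hτ => ?_), fun τ hτ => ?_⟩
  · simpa [eval_comp] using hQ _ (mem_arc_of_mem_ball p hab hτ)
  · simpa [eval_comp] using (hPQ _ (mem_arc_of_mem_ball p hab hτ)).le

/-- Both arc sums are arc sums over `𝒜(0, 1)`, of a Krasner analytic function and of its pullback under the
normalized map. -/
theorem hasArcIntegral_substitution {a b a₁ b₁ : ℂ_[p]} (hab : a ≠ b) {R : ℝ}
    {x : ℂ_[p] → ℂ_[p]} {u : ℕ → ℂ_[p]}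
    (hx : ∀ t ∈ Metric.closedBall a₁ R, HasSum (fun n => u n * (t - a₁) ^ n) (x t))
    (hxa : x a₁ = a)
    (hbij : Set.BijOn x (Metric.closedBall a₁ R) (Metric.closedBall a ‖b - a‖))
    {f : ℂ_[p] → ℂ_[p]} (hf : IsKrasnerAnalyticOn p f (arc p a b))
    (hb₁ : b₁ ∈ Metric.closedBall a₁ R) (hxb : x b₁ = b) (α : ℕ) :
    ∃ L : ℂ_[p], HasArcIntegral p (pathFamily α) a b f L ∧
      HasArcIntegral p (pathFamily α) a₁ b₁ (fun t => f (x t) * deriv x t) L := by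
  have hpK := norm_natCast_p_lt_one p
  have hβ : b - a ≠ 0 := sub_ne_zero.2 hab.symm
  have hR : ‖b₁ - a₁‖ = R := norm_sub_eq_of_norm_apply_sub_eq hp.out.one_lt hpK hx hxa
    (norm_pos_iff.2 hβ) hbij.mapsTo hb₁ (by rw [hxb])
  subst hR
  have hκ : b₁ - a₁ ≠ 0 := by
    intro h
    rw [sub_eq_zero.1 h, hxa] at hxb
    exact hab hxb
  obtain ⟨v, hv, hv0, -, hiff⟩ := exists_coeff_normalized hp.out.one_lt hpK hx hxa hκ hβ
  obtain ⟨hv1, hv2⟩ := hiff.1 hbij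
  have hvt := tendsto_coeff_zero (hv 1 (by simp))
  have hX1 : normalized x a₁ (b₁ - a₁) a (b - a) 1 = 1 := by
    rw [normalized, mul_one, add_sub_cancel, hxb, div_self hβ]
  have hfK := mem_krasnerSpace_of_isKrasnerAnalyticOn p hab hf
  have hcomp := tendsto_rootMean_pullback_sub hp.out hpK hvt hv hv0 hv1 hv2 hX1 hfK
  obtain ⟨L, hL⟩ := exists_rootMean_limit hp.out hpK α (exists_norm_pow_sub_lt_one p) hfK
  have hxX : ∀ τ, x (a₁ + (b₁ - a₁) * τ)
      = a + (b - a) * normalized x a₁ (b₁ - a₁) a (b - a) τ := by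
    intro τ
    rw [normalized, mul_div_cancel₀ _ hβ, add_sub_cancel]
  have hderiv : ∀ τ, ‖τ‖ ≤ 1 →
      (b₁ - a₁) * deriv x (a₁ + (b₁ - a₁) * τ) = (b - a) * seriesDeriv v τ := by
    intro τ hτ
    have h1 := hasDerivAt_of_hasSum hvt hv (norm_coeff_le_one_of_lt hv0 hv1 hv2) hτ
    have e : x = fun t => a + (b - a) *
        normalized x a₁ (b₁ - a₁) a (b - a) ((t - a₁) / (b₁ - a₁)) := by
      funext t
      rw [← hxX, mul_div_cancel₀ _ hκ, add_sub_cancel]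
    have e2 : (a₁ + (b₁ - a₁) * τ - a₁) / (b₁ - a₁) = τ := by
      rw [add_sub_cancel_left, mul_div_cancel_left₀ _ hκ]
    have h2 : HasDerivAt (fun t => (t - a₁) / (b₁ - a₁)) (1 / (b₁ - a₁)) (a₁ + (b₁ - a₁) * τ) :=
      ((hasDerivAt_id _).sub_const a₁).div_const (b₁ - a₁)
    have h3 := ((HasDerivAt.comp (a₁ + (b₁ - a₁) * τ) (by rw [e2]; exact h1) h2).const_mul
      (b - a)).const_add a
    have h4 : HasDerivAt x ((b - a) * (seriesDeriv v τ * (1 / (b₁ - a₁))))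
        (a₁ + (b₁ - a₁) * τ) := by
      rw [e]
      exact h3
    rw [h4.deriv]
    field_simp
  have hsum : ∀ N, arcSum p a₁ b₁ (fun t => f (x t) * deriv x t) N
      = rootMean p N (pullback v (normalized x a₁ (b₁ - a₁) a (b - a))
          fun τ => (b - a) * f (a + (b - a) * τ)) := by
    intro N
    rw [arcSum_eq_rootMean]
    refine rootMean_congr hp.out hpK N fun τ hτ => ?_
    rw [pullback, ← hxX, mul_left_comm, hderiv τ (norm_le_one_of_mem_ball hτ)]
    ring
  refine ⟨L, fun ε hε => ?_, fun ε hε => ?_⟩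
  · obtain ⟨l, hl, h⟩ := hL ε hε
    obtain ⟨k₀, hk₀⟩ := eventually_atTop.1 h
    refine ⟨k₀, fun k => α + l * k, ⟨l, hl, fun k => rfl⟩, fun k hk => ?_⟩
    rw [arcSum_eq_rootMean]
    exact hk₀ k hk.le
  · obtain ⟨l, hl, h⟩ := hL ε hε
    obtain ⟨N₀, hN₀⟩ := (Metric.tendsto_atTop.1 hcomp) ε hε
    obtain ⟨k₀, hk₀⟩ := eventually_atTop.1 h
    refine ⟨max k₀ N₀, fun k => α + l * k, ⟨l, hl, fun k => rfl⟩, fun k hk => ?_⟩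
    have h1 := hk₀ k ((le_max_left _ _).trans hk.le)
    have h2 := hN₀ (α + l * k) (by
      have : N₀ ≤ k := (le_max_right _ _).trans hk.le
      nlinarith)
    rw [dist_zero_right] at h2
    rw [hsum, ← sub_add_sub_cancel _ (rootMean p (α + l * k)
      fun τ => (b - a) * f (a + (b - a) * τ)) L]
    exact norm_add_lt_of_lt h2 h1

end PadicComplex

end ArcIntegral

theorem mainTheorem8 (p : ℕ) [Fact p.Prime] (hp : p ≠ 2)
    (a b a₁ : ℂ_[p]) (hab : a ≠ b) (R : ℝ) (hR : 0 < R)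
    (x : ℂ_[p] → ℂ_[p]) (hx : IsHolomorphicOnDisc p x a₁ R) (hxa : x a₁ = a) :
    (Set.BijOn x (Metric.closedBall a₁ R) (Metric.closedBall a ‖a - b‖) ↔
      ∃ (γ : ℂ_[p]) (g : ℂ_[p] → ℂ_[p]),
        ‖γ‖ = ‖a - b‖ / R ∧ IsHolomorphicOnDisc p g a₁ R ∧
        (∃ s < ‖a - b‖, ∀ t ∈ Metric.closedBall a₁ R, ‖g t‖ ≤ s) ∧
        ∀ t ∈ Metric.closedBall a₁ R, x t = a + γ * (t - a₁) + g t) ∧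
    (Set.BijOn x (Metric.closedBall a₁ R) (Metric.closedBall a ‖a - b‖) →
      ∀ f : ℂ_[p] → ℂ_[p], IsKrasnerAnalyticOn p f (arc p a b) →
      ∀ b₁ ∈ Metric.closedBall a₁ R, x b₁ = b →
      ∀ α : ℕ, ∃ L : ℂ_[p],
        HasArcIntegral p (pathFamily α) a b f L ∧
        HasArcIntegral p (pathFamily α) a₁ b₁ (fun t => f (x t) * deriv x t) L) := by
  obtain ⟨u, hu⟩ := hx
  refine ⟨ArcIntegral.bijOn_closedBall_iff (Fact.out : p.Prime).one_lt
    (ArcIntegral.norm_natCast_p_lt_one p) hu hxa hR (sub_ne_zero.2 hab), fun hbij f hf b₁ hb₁ hxb α => ?_⟩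
  rw [norm_sub_rev] at hbij
  exact ArcIntegral.hasArcIntegral_substitution p hab hu hxa hbij hf hb₁ hxb α
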